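/- Let $G$ be a finite subgroup of $\mathrm{GL}_2(\mathbb{C})$ which is small, i.e. contains no pseudo-reflections (elements $g$ with $\operatorname{rank}(g-1)=1$), and which is not contained in $\mathrm{SL}_2(\mathbb{C})$. Let $S=\mathbb{C}G$ and let $V=(\mathbb{C}^2)^*\otimes_{\mathbb{C}}\mathbb{C}G$ be the $S$-bimodule with $g(f\otimes a)=gf\otimes ga$ and $(f\otimes a)g=f\otimes ag$. Let $R\subseteq V\otimes_S V$ be the sub-bimodule generated by the commutators $(x\otimes 1)\otimes(y\otimes 1)-(y\otimes 1)\otimes(x\otimes 1)$, $x,y\in(\mathbb{C}^2)^*$. Then the canonical map $T_S(V)\to\mathbb{C}[\mathbb{C}^2]\rtimes G$, $f\otimes a\mapsto fa$, is surjective with kernel the two-sided ideal $I(R)$ generated by $R$, so that $\mathbb{C}[\mathbb{C}^2]\rtimes G=T_S(V)/I(R)$, and this algebra has no nontrivial PBW deformations relative to $\mathbb{C}G$. Here the PBW deformations are defined as follows. Let $F^n=\bigoplus_{i\le n}V^{\otimes_S i}$ and $F^{-1}=0$. A sub-bimodule $P\subseteq F^2$ whose projection to $V^{\otimes_S 2}$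 is $R$ is of PBW type if the canonical maps from $V^{\otimes_S n}$ to the degree $n$ part $\mathcal{A}^n/\mathcal{A}^{n-1}$ of the associated graded algebra of $\mathcal{A}=T_S(V)/I(P)$, where $\mathcal{A}^n$ is the image of $F^n$, induce an isomorphism $T_S(V)/I(R)\cong\operatorname{gr}\mathcal{A}$; then $\mathcal{A}$ is called a PBW deformation of $T_S(V)/I(R)$ relative to $S$. The assertion is that the only $P$ of PBW type is $P=R$, the trivial deformation. -/

import Mathlib

open scoped DirectSum TensorProduct MonoidAlgebra

noncomputable section

/-! ## The tensor algebra of a bimodule over a noncommutative ring -/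

namespace BimoduleTensor

section TensorAlgebra

variable (k S E : Type*) [Field k] [Ring S] [Algebra k S] [AddCommGroup E] [Module k E]
  [Module S E] [Module Sᵐᵒᵖ E]

/-- The relations that turn the free `k`-algebra on the vector space `S × E` into the tensor
algebra of the bimodule `E`: the copy of `S` becomes a subring, and the products of elements
of `S` with elements of `E` are given by the two module structures. -/
inductive Rel : TensorAlgebra k (S × E) → TensorAlgebra k (S × E) → Prop
  | one : Rel (TensorAlgebra.ι k ((1 : S), (0 : E))) 1
  | mul (s t : S) : Rel (TensorAlgebra.ι k (s * t, (0 : E)))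
      (TensorAlgebra.ι k (s, (0 : E)) * TensorAlgebra.ι k (t, (0 : E)))
  | left (s : S) (e : E) : Rel (TensorAlgebra.ι k ((0 : S), s • e))
      (TensorAlgebra.ι k (s, (0 : E)) * TensorAlgebra.ι k ((0 : S), e))
  | right (s : S) (e : E) : Rel (TensorAlgebra.ι k ((0 : S), MulOpposite.op s • e))
      (TensorAlgebra.ι k ((0 : S), e) * TensorAlgebra.ι k (s, (0 : E)))

/-- The tensor algebra `T_S(E) = S ⊕ E ⊕ (E ⊗_S E) ⊕ ⋯` of an `S`-bimodule `E`, as the universal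
`k`-algebra receiving an algebra map from `S` and a bimodule map from `E`
(see `BimoduleTensor.lift`). -/
def T : Type _ := RingQuot (Rel k S E)

instance : Ring (T k S E) := inferInstanceAs (Ring (RingQuot (Rel k S E)))

instance : Algebra k (T k S E) := inferInstanceAs (Algebra k (RingQuot (Rel k S E)))

/-- The quotient map from the free algebra on `S × E`. -/
def quot : TensorAlgebra k (S × E) →ₐ[k] T k S E := RingQuot.mkAlgHom k (Rel k S E)

variable {k S E} in
theorem quot_rel {x y : TensorAlgebra k (S × E)} (h : Rel k S E x y) :
    quot k S E x = quot k S E y := RingQuot.mkAlgHom_rel k h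

/-- The structure map `S → T_S(E)`. -/
def ofBase : S →ₐ[k] T k S E :=
  AlgHom.ofLinearMap
    ((quot k S E).toLinearMap ∘ₗ TensorAlgebra.ι k ∘ₗ LinearMap.inl k S E)
    ((quot_rel Rel.one).trans (map_one _))
    (fun s t => (quot_rel (Rel.mul s t)).trans (map_mul _ _ _))

/-- The canonical map `E → T_S(E)`. -/
def ofMod : E →ₗ[k] T k S E :=
  (quot k S E).toLinearMap ∘ₗ TensorAlgebra.ι k ∘ₗ LinearMap.inr k S E

variable {k S E}

theorem ofMod_smul (s : S) (e : E) :
    ofMod k S E (s • e) = ofBase k S E s * ofMod k S E e :=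
  (quot_rel (Rel.left s e)).trans (map_mul _ _ _)

theorem ofMod_op_smul (s : S) (e : E) :
    ofMod k S E (MulOpposite.op s • e) = ofMod k S E e * ofBase k S E s :=
  (quot_rel (Rel.right s e)).trans (map_mul _ _ _)

/-- The universal property of `T_S(E)`. -/
def lift {B : Type*} [Semiring B] [Algebra k B] (f : S →ₐ[k] B) (φ : E →ₗ[k] B)
    (hl : ∀ s e, φ (s • e) = f s * φ e) (hr : ∀ s e, φ (MulOpposite.op s • e) = φ e * f s) :
    T k S E →ₐ[k] B :=
  RingQuot.liftAlgHom k ⟨TensorAlgebra.lift k (f.toLinearMap.coprod φ), by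
    rintro _ _ (_ | _ | _ | _) <;> simp [hl, hr]⟩

section
variable {B : Type*} [Semiring B] [Algebra k B] (f : S →ₐ[k] B) (φ : E →ₗ[k] B)
    (hl : ∀ s e, φ (s • e) = f s * φ e) (hr : ∀ s e, φ (MulOpposite.op s • e) = φ e * f s)

@[simp] theorem lift_ofBase (s : S) : lift f φ hl hr (ofBase k S E s) = f s := by
  have : lift f φ hl hr (ofBase k S E s)
      = TensorAlgebra.lift k (f.toLinearMap.coprod φ) (TensorAlgebra.ι k (s, (0 : E))) :=
    RingQuot.liftAlgHom_mkAlgHom_apply _ _ _ _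
  simp [this]

@[simp] theorem lift_ofMod (e : E) : lift f φ hl hr (ofMod k S E e) = φ e := by
  have : lift f φ hl hr (ofMod k S E e)
      = TensorAlgebra.lift k (f.toLinearMap.coprod φ) (TensorAlgebra.ι k ((0 : S), e)) :=
    RingQuot.liftAlgHom_mkAlgHom_apply _ _ _ _
  simp [this]
end

theorem algHom_ext {B : Type*} [Semiring B] [Algebra k B] {F G : T k S E →ₐ[k] B}
    (h₀ : ∀ s, F (ofBase k S E s) = G (ofBase k S E s))
    (h₁ : ∀ e, F (ofMod k S E e) = G (ofMod k S E e)) : F = G := by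
  refine RingQuot.ringQuot_ext' (S := k) (s := Rel k S E) (f := F) (g := G) ?_
  refine TensorAlgebra.hom_ext (LinearMap.ext ?_)
  rintro ⟨s, e⟩
  have hd : (s, e) = (s, (0 : E)) + ((0 : S), e) := by simp
  rw [hd, map_add, map_add]
  exact congrArg₂ (· + ·) (h₀ s) (h₁ e)

variable (k S E)

/-- The degree `n` part `E ⊗_S ⋯ ⊗_S E` (`n` factors) of `T_S(E)`, which is `S` for `n = 0`. -/
def deg (n : ℕ) : Submodule k (T k S E) :=
  LinearMap.range (ofBase k S E).toLinearMap * LinearMap.range (ofMod k S E) ^ n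

theorem ofBase_mem (s : S) : ofBase k S E s ∈ deg k S E 0 := by
  rw [deg, pow_zero, mul_one]; exact ⟨s, rfl⟩

theorem range_base_mul_self :
    LinearMap.range (ofBase k S E).toLinearMap * LinearMap.range (ofBase k S E).toLinearMap
      ≤ LinearMap.range (ofBase k S E).toLinearMap := by
  rw [Submodule.mul_le]
  rintro _ ⟨s, rfl⟩ _ ⟨t, rfl⟩
  exact ⟨s * t, map_mul (ofBase k S E) s t⟩

theorem one_le_range_base : 1 ≤ LinearMap.range (ofBase k S E).toLinearMap := by
  rw [Submodule.one_le]; exact ⟨1, map_one (ofBase k S E)⟩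

theorem ofMod_mem (e : E) : ofMod k S E e ∈ deg k S E 1 := by
  rw [deg, pow_one, ← one_mul (ofMod k S E e)]
  exact Submodule.mul_mem_mul (Submodule.one_le.1 (one_le_range_base k S E)) ⟨e, rfl⟩

theorem pow_mul_range_base_le (n : ℕ) :
    LinearMap.range (ofMod k S E) ^ n * LinearMap.range (ofBase k S E).toLinearMap
      ≤ LinearMap.range (ofBase k S E).toLinearMap * LinearMap.range (ofMod k S E) ^ n := by
  induction n with
  | zero => simp
  | succ n ih =>
    have h : LinearMap.range (ofMod k S E) * LinearMap.range (ofBase k S E).toLinearMap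
        ≤ LinearMap.range (ofMod k S E) := by
      rw [Submodule.mul_le]
      rintro _ ⟨e, rfl⟩ _ ⟨t, rfl⟩
      exact ⟨MulOpposite.op t • e, ofMod_op_smul t e⟩
    rw [pow_succ, mul_assoc]
    calc _ ≤ LinearMap.range (ofMod k S E) ^ n * LinearMap.range (ofMod k S E) :=
          mul_le_mul' le_rfl h
      _ = 1 * (LinearMap.range (ofMod k S E) ^ n * LinearMap.range (ofMod k S E)) :=
          (one_mul _).symm
      _ ≤ _ := mul_le_mul' (one_le_range_base k S E) le_rfl

instance : SetLike.GradedMonoid (deg k S E) where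
  one_mem := by
    rw [← map_one (ofBase k S E)]; exact ofBase_mem k S E 1
  mul_mem := by
    intro i j x y hx hy
    refine (?_ : deg k S E i * deg k S E j ≤ deg k S E (i + j)) (Submodule.mul_mem_mul hx hy)
    unfold deg
    calc _ = LinearMap.range (ofBase k S E).toLinearMap *
            ((LinearMap.range (ofMod k S E) ^ i * LinearMap.range (ofBase k S E).toLinearMap) *
              LinearMap.range (ofMod k S E) ^ j) := by simp only [mul_assoc]
      _ ≤ LinearMap.range (ofBase k S E).toLinearMap *
            ((LinearMap.range (ofBase k S E).toLinearMap * LinearMap.range (ofMod k S E) ^ i) *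
              LinearMap.range (ofMod k S E) ^ j) :=
          mul_le_mul' le_rfl (mul_le_mul' (pow_mul_range_base_le k S E i) le_rfl)
      _ = (LinearMap.range (ofBase k S E).toLinearMap *
            LinearMap.range (ofBase k S E).toLinearMap) *
              LinearMap.range (ofMod k S E) ^ (i + j) := by simp only [mul_assoc, pow_add]
      _ ≤ _ := mul_le_mul' (range_base_mul_self k S E) le_rfl

/-- The structure map `S → T_S(E)`, with values in the graded pieces. -/
def gradedOfBase : S →ₐ[k] ⨁ i, deg k S E i :=
  AlgHom.ofLinearMap
    (DirectSum.lof k ℕ (fun i => deg k S E i) 0 ∘ₗ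
      (ofBase k S E).toLinearMap.codRestrict _ (ofBase_mem k S E))
    (by
      simp only [LinearMap.comp_apply, DirectSum.lof_eq_of]
      rw [DirectSum.one_def]
      congr 1
      exact Subtype.ext (map_one (ofBase k S E)))
    (fun s t => by
      simp only [LinearMap.comp_apply, DirectSum.lof_eq_of]
      rw [DirectSum.of_mul_of]
      exact DirectSum.of_eq_of_gradedMonoid_eq (Sigma.subtype_ext rfl (map_mul (ofBase k S E) s t)))

/-- The map `E → T_S(E)`, with values in the graded pieces. -/
def gradedOfMod : E →ₗ[k] ⨁ i, deg k S E i :=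
  DirectSum.lof k ℕ (fun i => deg k S E i) 1 ∘ₗ
    (ofMod k S E).codRestrict _ (ofMod_mem k S E)

/-- The map `T_S(E) → ⨁ₙ T_S(E)ₙ` that decomposes an element into its homogeneous parts. -/
def decomposeHom : T k S E →ₐ[k] ⨁ i, deg k S E i :=
  lift (gradedOfBase k S E) (gradedOfMod k S E)
    (fun s e => by
      simp only [gradedOfBase, gradedOfMod, AlgHom.ofLinearMap_apply, LinearMap.comp_apply,
        DirectSum.lof_eq_of]
      rw [DirectSum.of_mul_of]
      exact DirectSum.of_eq_of_gradedMonoid_eq (Sigma.subtype_ext rfl (ofMod_smul s e)))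
    (fun s e => by
      simp only [gradedOfBase, gradedOfMod, AlgHom.ofLinearMap_apply, LinearMap.comp_apply,
        DirectSum.lof_eq_of]
      rw [DirectSum.of_mul_of]
      exact DirectSum.of_eq_of_gradedMonoid_eq (Sigma.subtype_ext rfl (ofMod_op_smul s e)))

theorem decomposeHom_ofBase (s : S) : decomposeHom k S E (ofBase k S E s) =
    DirectSum.of (fun i => deg k S E i) 0 ⟨ofBase k S E s, ofBase_mem k S E s⟩ :=
  (lift_ofBase _ _ _ _ s).trans (DirectSum.lof_eq_of k ℕ (fun i => deg k S E i) _ _)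

theorem decomposeHom_ofMod (e : E) : decomposeHom k S E (ofMod k S E e) =
    DirectSum.of (fun i => deg k S E i) 1 ⟨ofMod k S E e, ofMod_mem k S E e⟩ :=
  (lift_ofMod _ _ _ _ e).trans (DirectSum.lof_eq_of k ℕ (fun i => deg k S E i) _ _)

/-- `decomposeHom` sends `x` to `x` placed in degree `n`. -/
def IsDecomposed (n : ℕ) (x : T k S E) : Prop :=
  ∃ h : x ∈ deg k S E n, decomposeHom k S E x = DirectSum.of (fun i => deg k S E i) n ⟨x, h⟩

variable {k S E}

theorem IsDecomposed.add {n : ℕ} {x y : T k S E} (hx : IsDecomposed k S E n x) (hy : IsDecomposed k S E n y) :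
    IsDecomposed k S E n (x + y) := by
  obtain ⟨h1, e1⟩ := hx
  obtain ⟨h2, e2⟩ := hy
  refine ⟨add_mem h1 h2, ?_⟩
  rw [map_add, e1, e2]
  exact (map_add (DirectSum.of (fun i => deg k S E i) n) ⟨x, h1⟩ ⟨y, h2⟩).symm

theorem IsDecomposed.mul {m n : ℕ} {x y : T k S E} (hx : IsDecomposed k S E m x) (hy : IsDecomposed k S E n y) :
    IsDecomposed k S E (m + n) (x * y) := by
  obtain ⟨h1, e1⟩ := hx
  obtain ⟨h2, e2⟩ := hy
  refine ⟨SetLike.mul_mem_graded h1 h2, ?_⟩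
  rw [map_mul, e1, e2]
  exact DirectSum.of_mul_of (A := fun i => deg k S E i) _ _

theorem isDecomposed_pow (n : ℕ) {x : T k S E} (hx : x ∈ LinearMap.range (ofMod k S E) ^ n) :
    IsDecomposed k S E n x := by
  induction hx using Submodule.pow_induction_on_left' with
  | algebraMap r =>
    rw [← AlgHom.commutes (ofBase k S E) r]
    exact ⟨_, decomposeHom_ofBase k S E _⟩
  | add x y i hx hy ihx ihy => exact ihx.add ihy
  | mem_mul m hm i x hx ih =>
    obtain ⟨e, rfl⟩ := hm
    rw [Nat.succ_eq_one_add]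
    exact IsDecomposed.mul ⟨_, decomposeHom_ofMod k S E e⟩ ih

theorem isDecomposed_of_mem {n : ℕ} {x : T k S E} (hx : x ∈ deg k S E n) : IsDecomposed k S E n x := by
  unfold deg at hx
  induction hx using Submodule.mul_induction_on' with
  | mem_mul_mem a ha b hb =>
    obtain ⟨s, rfl⟩ := ha
    rw [← zero_add n]
    exact IsDecomposed.mul ⟨_, decomposeHom_ofBase k S E s⟩ (isDecomposed_pow n hb)
  | add a ha b hb iha ihb => exact iha.add ihb

variable (k S E)

theorem coe_comp_decomposeHom :
    (DirectSum.coeAlgHom (deg k S E)).comp (decomposeHom k S E) = AlgHom.id k (T k S E) := by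
  refine algHom_ext (fun s => ?_) (fun e => ?_)
  · rw [AlgHom.comp_apply, decomposeHom_ofBase, DirectSum.coeAlgHom_of, AlgHom.id_apply]
  · rw [AlgHom.comp_apply, decomposeHom_ofMod, DirectSum.coeAlgHom_of, AlgHom.id_apply]

instance : GradedAlgebra (deg k S E) :=
  GradedAlgebra.ofAlgHom _ (decomposeHom k S E) (coe_comp_decomposeHom k S E)
    (fun _ x => (isDecomposed_of_mem x.2).2)

/-! ## Deformations of PBW type -/

/-- `F^n = T_S(E)ₙ ⊕ ⋯ ⊕ T_S(E)₀`. -/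
def filt (n : ℕ) : Submodule k (T k S E) := ⨆ i ≤ n, deg k S E i

/-- `F^{n-1}`, which is `0` for `n = 0`. -/
def filtPred (n : ℕ) : Submodule k (T k S E) := ⨆ i < n, deg k S E i

variable {k S E}

/-- `P` is a sub-`S`-bimodule of `T_S(E)`. -/
def IsSubbimodule (P : Submodule k (T k S E)) : Prop :=
  ∀ s : S, ∀ p ∈ P, ofBase k S E s * p ∈ P ∧ p * ofBase k S E s ∈ P

/-- The two-sided ideal `I(P)` of `T_S(E)` generated by `P`: the span of all `a * p * b`. -/
def ideal (P : Submodule k (T k S E)) : Submodule k (T k S E) := ⊤ * P * ⊤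

/-- The filtered piece `𝒜^n` of `𝒜 = T_S(E)/I(P)`, the image of `F^n`. -/
def quotFilt (P : Submodule k (T k S E)) (n : ℕ) : Submodule k (T k S E ⧸ ideal P) :=
  (filt k S E n).map (ideal P).mkQ

/-- The filtered piece `𝒜^{n-1}` of `𝒜 = T_S(E)/I(P)`, which is `0` for `n = 0`. -/
def quotFiltPred (P : Submodule k (T k S E)) (n : ℕ) : Submodule k (T k S E ⧸ ideal P) :=
  (filtPred k S E n).map (ideal P).mkQ

/-- The degree `n` part `gr(𝒜)ₙ = 𝒜^n / 𝒜^{n-1}` of the associated graded algebra of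
`𝒜 = T_S(E)/I(P)`. -/
abbrev gr (P : Submodule k (T k S E)) (n : ℕ) : Type _ :=
  quotFilt P n ⧸ (quotFiltPred P n).submoduleOf (quotFilt P n)

/-- The canonical map `T_S(E)ₙ → gr(T_S(E)/I(P))ₙ`. -/
def toGr (P : Submodule k (T k S E)) (n : ℕ) : deg k S E n →ₗ[k] gr P n :=
  ((quotFiltPred P n).submoduleOf (quotFilt P n)).mkQ ∘ₗ
    ((ideal P).mkQ ∘ₗ (deg k S E n).subtype).codRestrict (quotFilt P n) (fun x =>
      Submodule.mem_map_of_mem (le_iSup₂_of_le (f := fun i (_ : i ≤ n) => deg k S E i)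
        n le_rfl le_rfl x.2))

/-- Let `R` be a sub-bimodule of `T_S(E)_N`, and `A = T_S(E)/I(R)`. A sub-bimodule `P` of `F^N`
whose projection to `T_S(E)_N` is `R` is of PBW type, and `𝒜 = T_S(E)/I(P)` is a PBW
deformation of `A` relative to `S`, if the canonical maps `T_S(E)ₙ → gr(𝒜)ₙ` induce
an isomorphism of graded bimodules from `A`, with `Aₙ = T_S(E)ₙ / I(R)ₙ`, to `gr(𝒜)`. -/
structure IsPBWType (N : ℕ) (R P : Submodule k (T k S E)) : Prop where
  isSubbimodule : IsSubbimodule P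
  le_filt : P ≤ filt k S E N
  map_proj : P.map (GradedAlgebra.proj (deg k S E) N) = R
  induces_iso : ∀ n, ∃ e : (deg k S E n ⧸ (ideal R).submoduleOf (deg k S E n)) ≃ₗ[k] gr P n,
    ∀ x, e (Submodule.Quotient.mk x) = toGr P n x

/-! The trivial deformation `P = R` is a PBW deformation. -/

theorem mem_filtPred_of_mem {i n : ℕ} (h : i < n) {x : T k S E} (hx : x ∈ deg k S E i) :
    x ∈ filtPred k S E n :=
  le_iSup₂_of_le (f := fun i (_ : i < n) => deg k S E i) i h le_rfl hx

theorem proj_of_mem {n : ℕ} {x : T k S E} (hx : x ∈ deg k S E n) :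
    GradedAlgebra.proj (deg k S E) n x = x := by
  rw [GradedAlgebra.proj_apply, DirectSum.decompose_of_mem_same _ hx]

theorem proj_of_mem_ne {m n : ℕ} (h : m ≠ n) {x : T k S E} (hx : x ∈ deg k S E m) :
    GradedAlgebra.proj (deg k S E) n x = 0 := by
  rw [GradedAlgebra.proj_apply, DirectSum.decompose_of_mem_ne _ hx h]

theorem proj_filtPred {n : ℕ} {x : T k S E} (hx : x ∈ filtPred k S E n) :
    GradedAlgebra.proj (deg k S E) n x = 0 := by
  have : filtPred k S E n ≤ LinearMap.ker (GradedAlgebra.proj (deg k S E) n) :=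
    iSup₂_le fun i hi y hy => proj_of_mem_ne hi.ne hy
  exact this hx

theorem filt_le (n : ℕ) : filt k S E n ≤ deg k S E n ⊔ filtPred k S E n := by
  refine iSup₂_le fun i hi => ?_
  rcases hi.eq_or_lt with rfl | h
  · exact le_sup_left
  · exact le_sup_of_le_right fun x hx => mem_filtPred_of_mem h hx

theorem toGr_surjective (P : Submodule k (T k S E)) (n : ℕ) : Function.Surjective (toGr P n) := by
  intro y
  obtain ⟨⟨y, hy⟩, rfl⟩ := Submodule.Quotient.mk_surjective _ y
  obtain ⟨f, hf, rfl⟩ := hy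
  obtain ⟨t, ht, u, hu, rfl⟩ := Submodule.mem_sup.1 (filt_le n hf)
  refine ⟨⟨t, ht⟩, ?_⟩
  refine (Submodule.Quotient.eq _).2 ?_
  change (ideal P).mkQ t - (ideal P).mkQ (t + u) ∈ quotFiltPred P n
  rw [map_add, sub_add_cancel_left]
  exact neg_mem (Submodule.mem_map_of_mem hu)

theorem toGr_eq_zero {P : Submodule k (T k S E)} {n : ℕ} {x : deg k S E n} :
    toGr P n x = 0 ↔ ∃ u ∈ filtPred k S E n, (x : T k S E) - u ∈ ideal P := by
  refine (Submodule.Quotient.mk_eq_zero _).trans ?_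
  change (ideal P).mkQ x ∈ quotFiltPred P n ↔ _
  constructor
  · rintro ⟨u, hu, h⟩
    exact ⟨u, hu, (Submodule.Quotient.eq _).1 h.symm⟩
  · rintro ⟨u, hu, h⟩
    exact ⟨u, hu, ((Submodule.Quotient.eq _).2 h).symm⟩

theorem le_iSup_deg : (⊤ : Submodule k (T k S E)) ≤ ⨆ i, deg k S E i :=
  (DirectSum.Decomposition.isInternal (deg k S E)).submodule_iSup_eq_top.ge

theorem proj_ideal {N : ℕ} {R : Submodule k (T k S E)} (hR : R ≤ deg k S E N) (n : ℕ) :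
    ideal R ≤ (ideal R).comap (GradedAlgebra.proj (deg k S E) n) := by
  have h : ideal R = ⨆ i, ⨆ j, deg k S E i * R * deg k S E j := by
    refine le_antisymm ?_ (iSup₂_le fun i j => mul_le_mul' (mul_le_mul' le_top le_rfl) le_top)
    refine (mul_le_mul' (mul_le_mul' le_iSup_deg le_rfl) le_iSup_deg).trans ?_
    simp only [Submodule.iSup_mul, Submodule.mul_iSup]
    exact le_of_eq iSup_comm
  conv_lhs => rw [h]
  refine iSup₂_le fun i j x hx => ?_
  have hd : x ∈ deg k S E (i + N + j) := by
    refine (?_ : deg k S E i * R * deg k S E j ≤ deg k S E (i + N + j)) hx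
    refine Submodule.mul_le.2 fun u hu b hb => SetLike.mul_mem_graded ?_ hb
    exact (Submodule.mul_le.2 fun a ha r hr => SetLike.mul_mem_graded ha (hR hr)) hu
  change GradedAlgebra.proj (deg k S E) n x ∈ ideal R
  by_cases hn : i + N + j = n
  · subst hn
    rw [proj_of_mem hd]
    exact (mul_le_mul' (mul_le_mul' le_top le_rfl) le_top :
      deg k S E i * R * deg k S E j ≤ ⊤ * R * ⊤) hx
  · rw [proj_of_mem_ne hn hd]
    exact zero_mem _

theorem isPBWType_self {N : ℕ} {R : Submodule k (T k S E)} (hR : R ≤ deg k S E N)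
    (hb : IsSubbimodule R) : IsPBWType N R R where
  isSubbimodule := hb
  le_filt := hR.trans (le_iSup₂_of_le (f := fun i (_ : i ≤ N) => deg k S E i) N le_rfl le_rfl)
  map_proj := by
    refine le_antisymm ?_ fun r hr => ⟨r, hr, proj_of_mem (hR hr)⟩
    rintro _ ⟨r, hr, rfl⟩
    rw [proj_of_mem (hR hr)]
    exact hr
  induces_iso n := by
    have hk : (ideal R).submoduleOf (deg k S E n) = LinearMap.ker (toGr R n) := by
      ext ⟨x, hx⟩
      rw [LinearMap.mem_ker, toGr_eq_zero]
      change x ∈ ideal R ↔ _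
      constructor
      · intro h
        exact ⟨0, zero_mem _, by rwa [sub_zero]⟩
      · rintro ⟨u, hu, h⟩
        have := proj_ideal hR n h
        rwa [Submodule.mem_comap, map_sub, proj_of_mem hx, proj_filtPred hu, sub_zero] at this
    exact ⟨(Submodule.quotEquivOfEq _ _ hk).trans
      ((toGr R n).quotKerEquivOfSurjective (toGr_surjective R n)), fun x => rfl⟩

end TensorAlgebra
end BimoduleTensor

/-! ## The skew group algebra of a finite subgroup of `GL₂(ℂ)` -/

namespace SkewGL

open Matrix

/-- A pseudo-reflection: its fixed space is a hyperplane. -/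
def IsPseudoReflection (g : GL (Fin 2) ℂ) : Prop :=
  ((g : Matrix (Fin 2) (Fin 2) ℂ) - 1).rank = 1

/-- A subgroup is small if it contains no pseudo-reflections. -/
def IsSmall (G : Subgroup (GL (Fin 2) ℂ)) : Prop := ∀ g ∈ G, ¬ IsPseudoReflection g

variable (G : Subgroup (GL (Fin 2) ℂ))

/-- The representation of `G` on `ℂ²`. -/
def natRep : Representation ℂ G (Fin 2 → ℂ) :=
  (Matrix.toLinAlgEquiv' (R := ℂ) (n := Fin 2) : _ →* _).comp
    ((Units.coeHom (Matrix (Fin 2) (Fin 2) ℂ)).comp G.subtype)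

/-- The space `(ℂ²)*` of linear forms on `ℂ²`. -/
abbrev Form : Type := Module.Dual ℂ (Fin 2 → ℂ)

/-- The algebra `ℂ[ℂ²] = Sym((ℂ²)*)` of polynomial functions on `ℂ²`. -/
def Poly : Type := SymmetricAlgebra ℂ Form

instance : CommRing Poly := inferInstanceAs (CommRing (SymmetricAlgebra ℂ Form))

instance : Algebra ℂ Poly := inferInstanceAs (Algebra ℂ (SymmetricAlgebra ℂ Form))

/-- The inclusion of the linear forms into `ℂ[ℂ²]`. -/
def lin : Form →ₗ[ℂ] Poly := SymmetricAlgebra.ι ℂ Form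

theorem poly_induction {p : Poly → Prop} (q : Poly) (hc : ∀ c, p (algebraMap ℂ Poly c))
    (hl : ∀ f, p (lin f)) (hm : ∀ a b, p a → p b → p (a * b))
    (ha : ∀ a b, p a → p b → p (a + b)) : p q :=
  SymmetricAlgebra.induction ℂ Form (motive := p) hc hl hm ha q

theorem poly_hom_ext {B : Type*} [Semiring B] [Algebra ℂ B] {F F' : Poly →ₐ[ℂ] B}
    (h : ∀ f, F (lin f) = F' (lin f)) : F = F' := by
  refine AlgHom.ext fun q => ?_
  induction q using poly_induction with
  | hc c => rw [AlgHom.commutes, AlgHom.commutes]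
  | hl f => exact h f
  | hm a b ha hb => rw [map_mul, map_mul, ha, hb]
  | ha a b ha hb => rw [map_add, map_add, ha, hb]

/-- `G` acts on `(ℂ²)*` by `(g f)(v) = f(g⁻¹ v)`, and on `ℂ[ℂ²]` by the algebra automorphisms
extending this. -/
def polyAct (g : G) : Poly →ₐ[ℂ] Poly :=
  SymmetricAlgebra.lift (A := Poly) (lin ∘ₗ (natRep G).dual g)

theorem polyAct_lin (g : G) (f : Form) : polyAct G g (lin f) = lin ((natRep G).dual g f) :=
  SymmetricAlgebra.lift_ι_apply (A := Poly) _ _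

instance : MulSemiringAction G Poly where
  smul g p := polyAct G g p
  one_smul p := by
    have : polyAct G 1 = AlgHom.id ℂ Poly := poly_hom_ext fun f => by
      rw [polyAct_lin, map_one]; rfl
    exact congrArg (fun φ => φ p) this
  mul_smul g h p := by
    have : polyAct G (g * h) = (polyAct G g).comp (polyAct G h) := poly_hom_ext fun f => by
      rw [AlgHom.comp_apply, polyAct_lin, polyAct_lin, polyAct_lin, map_mul]; rfl
    exact congrArg (fun φ => φ p) this
  smul_zero g := map_zero (polyAct G g)
  smul_add g := map_add (polyAct G g)
  smul_one g := map_one (polyAct G g)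
  smul_mul g := map_mul (polyAct G g)

variable {G} in
theorem smul_lin (g : G) (f : Form) : g • lin f = lin ((natRep G).dual g f) := polyAct_lin G g f

instance : SMulCommClass G ℂ Poly where
  smul_comm g c p := map_smul (polyAct G g) c p

/-- The skew group algebra `ℂ[ℂ²] ⋊ G`, in which `(f₁ g₁) (f₂ g₂) = f₁ (g₁ f₂) g₁ g₂`; the
element `f g` is `SkewMonoidAlgebra.single g f`. -/
abbrev SkewGroupAlgebra : Type := SkewMonoidAlgebra Poly G

/-- The `ℂG`-bimodule `(ℂ²)* ⊗ ℂG`, with `g (f ⊗ a) = g f ⊗ g a` and `(f ⊗ a) g = f ⊗ a g`. -/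
def Gen : Type := Form ⊗[ℂ] MonoidAlgebra ℂ G

instance : AddCommGroup (Gen G) := inferInstanceAs (AddCommGroup (Form ⊗[ℂ] MonoidAlgebra ℂ G))

instance : Module ℂ (Gen G) := inferInstanceAs (Module ℂ (Form ⊗[ℂ] MonoidAlgebra ℂ G))

/-- The left action of `ℂG` on `(ℂ²)* ⊗ ℂG`. -/
def leftAct : MonoidAlgebra ℂ G →ₐ[ℂ] Module.End ℂ (Gen G) :=
  ((natRep G).dual.tprod (Representation.leftRegular ℂ G)).asAlgebraHom

/-- The right action of `ℂG` on `(ℂ²)* ⊗ ℂG`. -/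
def rightAct : (MonoidAlgebra ℂ G)ᵐᵒᵖ →+* Module.End ℂ (Gen G) where
  toFun a := LinearMap.lTensor Form (LinearMap.mulRight ℂ a.unop)
  map_one' := by simp; rfl
  map_mul' a b := by
    refine TensorProduct.ext' fun f c => ?_
    change f ⊗ₜ[ℂ] (c * (b.unop * a.unop)) = f ⊗ₜ[ℂ] (c * b.unop * a.unop)
    rw [mul_assoc]
  map_zero' := by simp; rfl
  map_add' a b := by
    refine TensorProduct.ext' fun f c => ?_
    change f ⊗ₜ[ℂ] (c * (a.unop + b.unop)) = f ⊗ₜ[ℂ] (c * a.unop) + f ⊗ₜ[ℂ] (c * b.unop)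
    rw [mul_add, TensorProduct.tmul_add]

instance : Module (MonoidAlgebra ℂ G) (Gen G) := Module.compHom _ (leftAct G).toRingHom

instance : Module (MonoidAlgebra ℂ G)ᵐᵒᵖ (Gen G) := Module.compHom _ (rightAct G)

/-- The element `f ⊗ a` of `(ℂ²)* ⊗ ℂG`. -/
def gen (f : Form) (a : MonoidAlgebra ℂ G) : Gen G := f ⊗ₜ[ℂ] a

variable {G}

theorem leftRegular_eq (g : G) (a : MonoidAlgebra ℂ G) :
    Representation.leftRegular ℂ G g a = MonoidAlgebra.single g 1 * a := by
  induction a using MonoidAlgebra.induction_linear with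
  | zero => simp
  | add x y hx hy => rw [map_add, hx, hy, mul_add]
  | single h d => simp

theorem single_smul_gen (g : G) (c : ℂ) (f : Form) (a : MonoidAlgebra ℂ G) :
    (MonoidAlgebra.single g c • gen G f a : Gen G) =
      gen G ((natRep G).dual g f) (MonoidAlgebra.single g c * a) := by
  have h := Representation.asAlgebraHom_single
    ((natRep G).dual.tprod (Representation.leftRegular ℂ G)) g c
  have h1 : (c • ((natRep G).dual g f ⊗ₜ[ℂ] (Representation.leftRegular ℂ G g a)) :
      Form ⊗[ℂ] MonoidAlgebra ℂ G) =
      (natRep G).dual g f ⊗ₜ[ℂ] (MonoidAlgebra.single g c * a) := by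
    rw [leftRegular_eq, ← TensorProduct.tmul_smul, ← smul_mul_assoc, MonoidAlgebra.smul_single,
      smul_eq_mul, mul_one]
  exact (LinearMap.congr_fun h (f ⊗ₜ[ℂ] a)).trans h1

theorem op_smul_gen (b : MonoidAlgebra ℂ G) (f : Form) (a : MonoidAlgebra ℂ G) :
    (MulOpposite.op b • gen G f a : Gen G) = gen G f (a * b) := rfl

theorem gen_induction {p : Gen G → Prop} (e : Gen G) (h0 : p 0)
    (hg : ∀ f a, p (gen G f a)) (ha : ∀ x y, p x → p y → p (x + y)) : p e :=
  TensorProduct.induction_on (motive := p) e h0 hg ha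

variable (G)

/-- The tensor algebra `T_{ℂG}((ℂ²)* ⊗ ℂG)`. -/
abbrev Tens : Type := BimoduleTensor.T ℂ (MonoidAlgebra ℂ G) (Gen G)

/-- The element `x ⊗ 1` of `T_{ℂG}((ℂ²)* ⊗ ℂG)`, for a linear form `x`. -/
def var (x : Form) : Tens G := BimoduleTensor.ofMod ℂ (MonoidAlgebra ℂ G) (Gen G) (gen G x 1)

/-- The inclusion of `ℂG` in `T_{ℂG}((ℂ²)* ⊗ ℂG)`. -/
abbrev base : MonoidAlgebra ℂ G →ₐ[ℂ] Tens G :=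
  BimoduleTensor.ofBase ℂ (MonoidAlgebra ℂ G) (Gen G)

/-- The `ℂG`-bimodule `R ⊆ T_{ℂG}((ℂ²)* ⊗ ℂG)₂` generated by the commutators `[x, y]` of linear
forms `x`, `y`. -/
def relations : Submodule ℂ (Tens G) :=
  Submodule.span ℂ {t | ∃ (a b : MonoidAlgebra ℂ G) (x y : Form),
    t = base G a * (var G x * var G y - var G y * var G x) * base G b}

/-- The inclusion `ℂG → ℂ[ℂ²] ⋊ G`. -/
def groupIncl : MonoidAlgebra ℂ G →ₐ[ℂ] SkewGroupAlgebra G :=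
  MonoidAlgebra.lift ℂ _ G (SkewMonoidAlgebra.of Poly G)

/-- The map `(ℂ²)* ⊗ ℂG → ℂ[ℂ²] ⋊ G`, `f ⊗ a ↦ f a`. -/
def genIncl : Gen G →ₗ[ℂ] SkewGroupAlgebra G :=
  TensorProduct.lift ((LinearMap.mul ℂ (SkewGroupAlgebra G)).compl₁₂
    ((SkewMonoidAlgebra.lsingle (R := ℂ) (1 : G)) ∘ₗ lin) (groupIncl G).toLinearMap)

variable {G}

theorem groupIncl_single (g : G) (c : ℂ) : groupIncl G (MonoidAlgebra.single g c) =
    c • SkewMonoidAlgebra.single g 1 := by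
  simp [groupIncl]

theorem genIncl_gen (f : Form) (a : MonoidAlgebra ℂ G) : genIncl G (gen G f a) =
    SkewMonoidAlgebra.single 1 (lin f) * groupIncl G a := rfl

theorem genIncl_smul (s : MonoidAlgebra ℂ G) (e : Gen G) :
    genIncl G (s • e) = groupIncl G s * genIncl G e := by
  induction e using gen_induction with
  | h0 => simp
  | ha x y hx hy => rw [smul_add, map_add, hx, hy, map_add, mul_add]
  | hg f a =>
    induction s using MonoidAlgebra.induction_linear with
    | zero => simp
    | add x y hx hy => rw [add_smul, map_add, hx, hy, map_add, add_mul]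
    | single g c =>
      rw [single_smul_gen, genIncl_gen, genIncl_gen, map_mul, ← mul_assoc, ← mul_assoc]
      refine congrArg (· * _) ?_
      rw [groupIncl_single, mul_smul_comm, smul_mul_assoc, SkewMonoidAlgebra.single_mul_single,
        SkewMonoidAlgebra.single_mul_single, smul_lin]
      simp

theorem genIncl_op_smul (s : MonoidAlgebra ℂ G) (e : Gen G) :
    genIncl G (MulOpposite.op s • e) = genIncl G e * groupIncl G s := by
  induction e using gen_induction with
  | h0 => simp
  | ha x y hx hy => rw [smul_add, map_add, hx, hy, map_add, add_mul]
  | hg f a => rw [op_smul_gen, genIncl_gen, genIncl_gen, map_mul, mul_assoc]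

variable (G)

/-- The canonical map `T_{ℂG}((ℂ²)* ⊗ ℂG) → ℂ[ℂ²] ⋊ G`. -/
def toSkew : Tens G →ₐ[ℂ] SkewGroupAlgebra G :=
  BimoduleTensor.lift (groupIncl G) (genIncl G) genIncl_smul genIncl_op_smul


theorem toSkew_base (a : MonoidAlgebra ℂ G) : toSkew G (base G a) = groupIncl G a :=
  BimoduleTensor.lift_ofBase _ _ _ _ _

theorem toSkew_var (f : Form) : toSkew G (var G f) = SkewMonoidAlgebra.single 1 (lin f) := by
  rw [toSkew, var, BimoduleTensor.lift_ofMod, genIncl_gen, map_one, mul_one]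

theorem ofMod_gen (f : Form) (a : MonoidAlgebra ℂ G) :
    BimoduleTensor.ofMod ℂ (MonoidAlgebra ℂ G) (Gen G) (gen G f a) = var G f * base G a := by
  rw [var, ← BimoduleTensor.ofMod_op_smul, op_smul_gen, one_mul]

theorem toSkew_surjective : Function.Surjective (toSkew G) := by
  have h1 : ∀ p : Poly, (SkewMonoidAlgebra.single (1 : G) p : SkewGroupAlgebra G) ∈
      (toSkew G).range := by
    intro p
    induction p using poly_induction with
    | hc c => exact (toSkew G).range.algebraMap_mem c
    | hl f => exact ⟨var G f, toSkew_var G f⟩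
    | hm a b ha hb =>
      have := (toSkew G).range.mul_mem ha hb
      rwa [SkewMonoidAlgebra.single_mul_single, one_smul, mul_one] at this
    | ha a b ha hb => rw [SkewMonoidAlgebra.single_add]; exact add_mem ha hb
  intro x
  change x ∈ (toSkew G).range
  induction x using SkewMonoidAlgebra.induction_on' with
  | single g p =>
    have h2 : (SkewMonoidAlgebra.single g 1 : SkewGroupAlgebra G) ∈ (toSkew G).range :=
      ⟨base G (MonoidAlgebra.single g 1), (toSkew_base G _).trans (by rw [groupIncl_single, one_smul])⟩
    have := (toSkew G).range.mul_mem (h1 p) h2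
    rwa [SkewMonoidAlgebra.single_mul_single, one_smul, mul_one, one_mul] at this
  | add x y hx hy => exact add_mem hx hy

theorem ideal_le_ker :
    BimoduleTensor.ideal (relations G) ≤ LinearMap.ker (toSkew G).toLinearMap := by
  have h : relations G ≤ LinearMap.ker (toSkew G).toLinearMap := by
    refine Submodule.span_le.2 ?_
    rintro _ ⟨a, b, x, y, rfl⟩
    change toSkew G _ = 0
    rw [map_mul, map_mul, map_sub, map_mul, map_mul, toSkew_var, toSkew_var,
      SkewMonoidAlgebra.single_mul_single, SkewMonoidAlgebra.single_mul_single, one_smul, one_smul,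
      mul_comm (lin x), sub_self, mul_zero, zero_mul]
  refine Submodule.mul_le.2 fun u hu c _ => ?_
  change toSkew G (u * c) = 0
  have hu0 : toSkew G u = 0 := by
    refine (Submodule.mul_le (P := LinearMap.ker (toSkew G).toLinearMap)).2
      (fun a _ r hr => ?_) hu
    change toSkew G (a * r) = 0
    rw [map_mul, show toSkew G r = 0 from h hr, mul_zero]
  rw [map_mul, hu0, zero_mul]

/-- `ideal P` as a two-sided ideal. -/
def twoSided (P : Submodule ℂ (Tens G)) : TwoSidedIdeal (Tens G) :=
  TwoSidedIdeal.mk' (BimoduleTensor.ideal P : Set (Tens G)) (zero_mem _)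
    (fun h h' => add_mem h h') (fun h => neg_mem h)
    (fun {x y} h => by
      have := Submodule.mul_mem_mul (Submodule.mem_top (x := x) (R := ℂ)) h
      rw [BimoduleTensor.ideal, ← mul_assoc, ← mul_assoc] at this
      exact (mul_le_mul' (mul_le_mul' le_top le_rfl) le_rfl :
        (⊤ * ⊤ * P * ⊤ : Submodule ℂ (Tens G)) ≤ ⊤ * P * ⊤) this)
    (fun {x y} h => by
      have := Submodule.mul_mem_mul h (Submodule.mem_top (x := y) (R := ℂ))
      rw [BimoduleTensor.ideal, mul_assoc] at this
      exact (mul_le_mul' le_rfl le_top : (⊤ * P * (⊤ * ⊤) : Submodule ℂ (Tens G)) ≤ ⊤ * P * ⊤) this)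

/-- The extension of a linear map on linear forms, with commuting values, to `ℂ[ℂ²]`. -/
def polyLift {B : Type*} [Ring B] [Algebra ℂ B] (φ : Form →ₗ[ℂ] B)
    (h : ∀ x y, φ x * φ y = φ y * φ x) : Poly →ₐ[ℂ] B :=
  RingCon.liftₐ (TensorAlgebra.symRingCon ℂ Form) (TensorAlgebra.lift ℂ φ) (by
    refine RingCon.ringConGen_le.2 ?_
    rintro _ _ ⟨x, y⟩
    simpa using h x y)

theorem polyLift_lin {B : Type*} [Ring B] [Algebra ℂ B] (φ : Form →ₗ[ℂ] B)
    (h : ∀ x y, φ x * φ y = φ y * φ x) (f : Form) : polyLift φ h (lin f) = φ f :=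
  TensorAlgebra.lift_ι_apply φ f

theorem base_mul_var (g : G) (f : Form) : base G (MonoidAlgebra.single g 1) * var G f =
    var G ((natRep G).dual g f) * base G (MonoidAlgebra.single g 1) := by
  rw [← ofMod_gen, var, ← BimoduleTensor.ofMod_smul, single_smul_gen, mul_one]

theorem commutator_mem (x y : Form) :
    var G x * var G y - var G y * var G x ∈ BimoduleTensor.ideal (relations G) := by
  have h : var G x * var G y - var G y * var G x ∈ relations G :=
    Submodule.subset_span ⟨1, 1, x, y, by rw [map_one, one_mul, mul_one]⟩
  have := Submodule.mul_mem_mul (Submodule.mul_mem_mul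
    (Submodule.mem_top (x := (1 : Tens G)) (R := ℂ)) h)
    (Submodule.mem_top (x := (1 : Tens G)) (R := ℂ))
  rwa [one_mul, mul_one] at this

theorem ker_le_ideal :
    LinearMap.ker (toSkew G).toLinearMap ≤ BimoduleTensor.ideal (relations G) := by
  set J := twoSided G (relations G) with hJ
  have hmem : ∀ t, t ∈ J ↔ t ∈ BimoduleTensor.ideal (relations G) := fun t =>
    TwoSidedIdeal.mem_mk' _ _ _ _ _ _ _
  let q : Tens G →ₐ[ℂ] J.ringCon.Quotient := RingCon.mkₐ ℂ J.ringCon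
  have hq : ∀ t, q t = 0 → t ∈ BimoduleTensor.ideal (relations G) := fun t ht =>
    (hmem t).1 ((RingCon.eq J.ringCon).1 ht)
  have hq' : ∀ t, t ∈ BimoduleTensor.ideal (relations G) → q t = 0 := fun t ht =>
    (RingCon.eq J.ringCon).2 ((hmem t).2 ht)
  let φ : Form →ₗ[ℂ] J.ringCon.Quotient := q.toLinearMap ∘ₗ
    BimoduleTensor.ofMod ℂ (MonoidAlgebra ℂ G) (Gen G) ∘ₗ
      (TensorProduct.mk ℂ Form (MonoidAlgebra ℂ G)).flip 1
  have hφ : ∀ f, φ f = q (var G f) := fun f => rfl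
  let F : Poly →ₐ[ℂ] J.ringCon.Quotient := polyLift φ (fun x y => by
    rw [hφ, hφ, ← sub_eq_zero, ← map_mul, ← map_mul, ← map_sub]
    exact hq' _ (commutator_mem G x y))
  have hF : ∀ f, F (lin f) = q (var G f) := fun f => polyLift_lin _ _ f
  let γ : G →* J.ringCon.Quotient :=
    ((q.comp (base G) : MonoidAlgebra ℂ G →* J.ringCon.Quotient)).comp (MonoidAlgebra.of ℂ G)
  have hγ : ∀ g, γ g = q (base G (MonoidAlgebra.single g 1)) := fun g => rfl
  have hc : ∀ (p : Poly) (g : G), F (g • p) * γ g = γ g * F p := by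
    intro p g
    induction p using poly_induction with
    | hc c => rw [smul_algebraMap, AlgHom.commutes, Algebra.commutes]
    | hl f => rw [smul_lin, hF, hF, hγ, ← map_mul, ← map_mul, base_mul_var]
    | hm a b ha hb => rw [smul_mul', map_mul, map_mul, mul_assoc, hb, ← mul_assoc, ha, mul_assoc]
    | ha a b ha hb => rw [smul_add, map_add, map_add, add_mul, mul_add, ha, hb]
  let ψ : SkewGroupAlgebra G →ₐ[ℂ] J.ringCon.Quotient :=
    SkewMonoidAlgebra.liftNCAlgHom F γ (fun {x y} => hc x y)
  have hψ : ∀ g p, ψ (SkewMonoidAlgebra.single g p) = F p * γ g := fun g p =>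
    SkewMonoidAlgebra.liftNC_single _ _ _ _
  have hψb : ∀ a, ψ (toSkew G (base G a)) = q (base G a) := by
    intro a
    rw [toSkew_base]
    induction a using MonoidAlgebra.induction_linear with
    | zero => simp only [map_zero]
    | add x y hx hy => rw [map_add, map_add, hx, hy, map_add, map_add]
    | single g c =>
      have : (MonoidAlgebra.single g c : MonoidAlgebra ℂ G) = c • MonoidAlgebra.single g 1 := by
        rw [MonoidAlgebra.smul_single, smul_eq_mul, mul_one]
      rw [groupIncl_single, map_smul, hψ, map_one, one_mul, hγ, this, map_smul, map_smul]
  have key : ψ.comp (toSkew G) = q := by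
    refine BimoduleTensor.algHom_ext hψb fun e => ?_
    induction e using gen_induction with
    | h0 => simp only [map_zero]
    | hg f a =>
      rw [ofMod_gen, map_mul, map_mul, AlgHom.comp_apply, AlgHom.comp_apply, hψb, toSkew_var, hψ,
        hF, map_one, mul_one]
    | ha x y hx hy => rw [map_add, map_add, map_add, hx, hy]
  intro t ht
  refine hq t ?_
  rw [← key, AlgHom.comp_apply, show toSkew G t = 0 from ht, map_zero]

theorem ker_toSkew :
    LinearMap.ker (toSkew G).toLinearMap = BimoduleTensor.ideal (relations G) :=
  le_antisymm (ker_le_ideal G) (ideal_le_ker G)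

theorem relations_le_deg :
    relations G ≤ BimoduleTensor.deg ℂ (MonoidAlgebra ℂ G) (Gen G) 2 := by
  refine Submodule.span_le.2 ?_
  rintro _ ⟨a, b, x, y, rfl⟩
  rw [SetLike.mem_coe]
  have hv : ∀ f, var G f ∈ BimoduleTensor.deg ℂ (MonoidAlgebra ℂ G) (Gen G) 1 := fun f =>
    BimoduleTensor.ofMod_mem ℂ _ _ _
  have hb : ∀ a, base G a ∈ BimoduleTensor.deg ℂ (MonoidAlgebra ℂ G) (Gen G) 0 := fun a =>
    BimoduleTensor.ofBase_mem ℂ _ _ _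
  exact SetLike.mul_mem_graded (i := 2) (j := 0) (SetLike.mul_mem_graded (i := 0) (j := 2) (hb a)
    (sub_mem (SetLike.mul_mem_graded (i := 1) (j := 1) (hv x) (hv y))
      (SetLike.mul_mem_graded (i := 1) (j := 1) (hv y) (hv x)))) (hb b)

theorem relations_isSubbimodule : BimoduleTensor.IsSubbimodule (relations G) := by
  intro s p hp
  induction hp using Submodule.span_induction with
  | mem t ht =>
    obtain ⟨a, b, x, y, rfl⟩ := ht
    exact ⟨Submodule.subset_span ⟨s * a, b, x, y, by rw [map_mul]; simp only [mul_assoc]⟩,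
      Submodule.subset_span ⟨a, b * s, x, y, by rw [map_mul]; simp only [mul_assoc]⟩⟩
  | zero => simp
  | add x y _ _ hx hy =>
    rw [mul_add, add_mul]
    exact ⟨add_mem hx.1 hy.1, add_mem hx.2 hy.2⟩
  | smul c x _ hx =>
    rw [mul_smul_comm, smul_mul_assoc]
    exact ⟨Submodule.smul_mem _ c hx.1, Submodule.smul_mem _ c hx.2⟩

end SkewGL
end

/-! The presentation of the skew group algebra is `toSkew_surjective` and `ker_toSkew`; what remains
is rigidity. Let R be `relations G`, V the bimodule `Gen G`, and P of PBW type. Then P meets F^1 =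
ℂG ⊕ V only in 0 (`IsPBWType.eq_zero`), so P is the graph of a bimodule map R → F^1. The bimodule R
is generated by the commutator ω of the two coordinates (`commutator_eq`), which h ∈ G conjugates to
det(h⁻¹) ω (`base_conj_coordComm`). So P is determined by one element ω + u, where u ∈ F^1 satisfies
h u h⁻¹ = det(h⁻¹) u.

Let s_g ∈ ℂ and E_g ∈ (ℂ²)* be the coefficients of u at g. Then h E_g = det(h⁻¹) E_{hgh⁻¹} and s_g =
det(h⁻¹) s_{hgh⁻¹}. If E_g ≠ 0, taking h = g makes det(g⁻¹) an eigenvalue of g⁻¹, so the other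
eigenvalue is 1 and g = 1 by smallness; taking h = k₀ with det k₀ ≠ 1 excludes g = 1 in the same
way. And s_g = 0 as soon as some h with det h ≠ 1 commutes with g, which is
`exists_commute_det_ne_one`.

That lemma is a counting argument. Suppose the centralizer C of g lies in SL₂, and let T be the
centralizer of k₀. The center Z then acts by ±1, and commuting is transitive outside Z. T is its own
normalizer and [T : Z] ≥ 4, so the conjugates of T \ Z fill at least 3/4 of the group. C has index
at most 2 in its normalizer and [C : Z] ≥ 2, so the conjugates of C \ Z fill at least 1/4. The two
families are disjoint by determinants, and both miss the identity: a contradiction. -/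

namespace SmallGroup

open Matrix

/-! ### Two-by-two matrices -/

section Matrices

variable {a b : Matrix (Fin 2) (Fin 2) ℂ}

/-- A scalar multiple of the identity matrix. -/
def IsScalar (a : Matrix (Fin 2) (Fin 2) ℂ) : Prop := ∃ c : ℂ, a = c • 1

theorem det_sub_one_eq (a : Matrix (Fin 2) (Fin 2) ℂ) : (a - 1).det = 1 - a.trace + a.det := by
  simp [det_fin_two, trace_fin_two]; ring

theorem det_add_one_eq (a : Matrix (Fin 2) (Fin 2) ℂ) : (a + 1).det = 1 + a.trace + a.det := by
  simp [det_fin_two, trace_fin_two]; ring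

theorem mul_self_eq (a : Matrix (Fin 2) (Fin 2) ℂ) : a * a = a.trace • a - a.det • 1 := by
  ext i j
  fin_cases i <;> fin_cases j <;>
    simp [det_fin_two, trace_fin_two, mul_apply, Fin.sum_univ_two] <;> ring

theorem eq_zero_of_smul_eq_smul_one (ha : ¬ IsScalar a) {c d : ℂ} (h : c • a = d • 1) :
    c = 0 ∧ d = 0 := by
  have hc : c = 0 := by
    by_contra hc
    exact ha ⟨c⁻¹ * d, by rw [← smul_smul, ← h, smul_smul, inv_mul_cancel₀ hc, one_smul]⟩
  subst hc
  have := congrFun (congrFun h 0) 0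
  simp at this
  exact ⟨rfl, this.symm⟩

/-- Modulo scalars a matrix x is the triple (x₀₁, x₁₀, x₀₀ − x₁₁), and commuting means that the
cross product of the two triples vanishes. The triple of a nonscalar `a` is nonzero, so that of `b`
is a multiple of it; β is the ratio at any nonzero entry. -/
theorem exists_eq_of_commute (ha : ¬ IsScalar a) (h : Commute a b) :
    ∃ α β : ℂ, b = α • 1 + β • a := by
  have e := h.eq
  have h00 := congrFun (congrFun e 0) 0
  have h01 := congrFun (congrFun e 0) 1
  have h10 := congrFun (congrFun e 1) 0
  simp only [mul_apply, Fin.sum_univ_two] at h00 h01 h10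
  have key : ∀ β : ℂ, b 0 1 = β * a 0 1 → b 1 0 = β * a 1 0 →
      b 0 0 - b 1 1 = β * (a 0 0 - a 1 1) → ∃ α β : ℂ, b = α • 1 + β • a := by
    intro β h1 h2 h3
    refine ⟨b 0 0 - β * a 0 0, β, ?_⟩
    ext i j
    fin_cases i <;> fin_cases j <;> simp [h1, h2]
    linear_combination -h3
  by_cases hq : a 0 1 = 0
  · by_cases hr : a 1 0 = 0
    · have hs : a 0 0 - a 1 1 ≠ 0 := by
        intro hs
        refine ha ⟨a 0 0, ?_⟩
        ext i j
        fin_cases i <;> fin_cases j <;> simp [hq, hr]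
        linear_combination -hs
      refine key ((b 0 0 - b 1 1) / (a 0 0 - a 1 1)) ?_ ?_ ?_
      · rw [hq, mul_zero]
        refine (mul_eq_zero.1 (?_ : (a 0 0 - a 1 1) * b 0 1 = 0)).resolve_left hs
        linear_combination h01 + (b 0 0 - b 1 1) * hq
      · rw [hr, mul_zero]
        refine (mul_eq_zero.1 (?_ : (a 0 0 - a 1 1) * b 1 0 = 0)).resolve_left hs
        linear_combination -h10 + (b 0 0 - b 1 1) * hr
      · rw [div_mul_cancel₀ _ hs]
    · refine key (b 1 0 / a 1 0) ?_ ?_ ?_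
      · field_simp
        linear_combination -h00
      · field_simp
      · field_simp
        linear_combination h10
  · refine key (b 0 1 / a 0 1) ?_ ?_ ?_
    · field_simp
    · field_simp
      linear_combination h00
    · field_simp
      linear_combination -h01

theorem commute_of_commute {c : Matrix (Fin 2) (Fin 2) ℂ} (ha : ¬ IsScalar a) (hb : Commute a b)
    (hc : Commute a c) : Commute b c := by
  obtain ⟨α, β, rfl⟩ := exists_eq_of_commute ha hb
  exact ((Commute.one_left c).smul_left α).add_left (hc.smul_left β)

/-- A matrix of finite order is diagonalizable: its discriminant vanishes only if it is scalar. -/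
theorem disc_ne_zero (ha : ¬ IsScalar a) {n : ℕ} (hn : n ≠ 0) (h : a ^ n = 1) :
    a.trace ^ 2 - 4 * a.det ≠ 0 := by
  intro hd
  obtain ⟨n, rfl⟩ := Nat.exists_eq_succ_of_ne_zero hn
  -- If the discriminant vanishes, c is the double eigenvalue and t = a − c is nilpotent.
  set c : ℂ := a.trace / 2 with hc
  set t : Matrix (Fin 2) (Fin 2) ℂ := a - c • 1 with ht
  have hat : a = c • 1 + t := by rw [ht]; abel
  have htt : t * t = 0 := by
    have h2 : a.trace = 2 * c := by rw [hc]; ring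
    have h3 : a.det = c * c := by rw [h2] at hd; linear_combination -hd / 4
    have := mul_self_eq a
    rw [h2, h3] at this
    rw [ht, sub_mul, mul_sub, this]
    ext i j
    simp
    ring
  have hpow : ∀ m : ℕ, a ^ (m + 1) = c ^ (m + 1) • 1 + ((m + 1 : ℂ) * c ^ m) • t := by
    intro m
    induction m with
    | zero => simpa using hat
    | succ m ih =>
      rw [pow_succ, ih]
      nth_rewrite 1 [hat]
      rw [add_mul, mul_add, mul_add, smul_mul_smul_comm, smul_mul_smul_comm, smul_mul_assoc,
        smul_mul_assoc, htt]
      ext i j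
      simp
      ring
  rw [hpow n] at h
  -- A power of `a` equal to 1 would express a multiple of the nonscalar `a` as a scalar, so the
  -- coefficient of t must vanish.
  have h1 : ((n + 1 : ℂ) * c ^ n) • a = (1 - c ^ (n + 1) + ((n + 1 : ℂ) * c ^ n) * c) • 1 := by
    nth_rewrite 1 [hat]
    rw [smul_add, add_smul, sub_smul, one_smul, eq_sub_of_add_eq' h, smul_smul, add_comm]
  have h2 := (eq_zero_of_smul_eq_smul_one ha h1).1
  have hc0 : c ≠ 0 := by
    intro hc0
    rw [h2, hc0] at h
    have := congrFun (congrFun h 0) 0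
    simp at this
  exact (mul_ne_zero (Nat.cast_add_one_ne_zero n) (pow_ne_zero n hc0)) h2

/-- In a common eigenbasis `b` has the eigenvalues of `a` in the same or in the opposite order.
Algebraically, b = α + βa has discriminant β² times that of `a`, whence β = ±1. -/
theorem eq_or_eq_of_commute (ha : ¬ IsScalar a) (hd : a.trace ^ 2 - 4 * a.det ≠ 0)
    (h : Commute a b) (ht : b.trace = a.trace) (hdet : b.det = a.det) :
    b = a ∨ b = a.trace • 1 - a := by
  obtain ⟨α, β, rfl⟩ := exists_eq_of_commute ha h
  simp only [det_fin_two, trace_fin_two, Matrix.add_apply, Matrix.smul_apply, smul_eq_mul, one_apply_eq, ne_eq,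
    one_apply_ne, zero_ne_one, one_ne_zero, not_false_eq_true, mul_zero, mul_one, zero_add]
    at ht hdet hd ⊢
  have hβ : (β - 1) * (β + 1) = 0 := by
    refine (mul_eq_zero.1 (?_ : _ * ((a 0 0 + a 1 1) ^ 2 -
      4 * (a 0 0 * a 1 1 - a 0 1 * a 1 0)) = 0)).resolve_right hd
    linear_combination (2 * α + (β + 1) * (a 0 0 + a 1 1)) * ht - 4 * hdet
  rcases mul_eq_zero.1 hβ with hb | hb
  · left
    obtain rfl : β = 1 := by linear_combination hb
    obtain rfl : α = 0 := by linear_combination ht / 2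
    simp
  · right
    obtain rfl : β = -1 := by linear_combination hb
    obtain rfl : α = a 0 0 + a 1 1 := by linear_combination ht / 2
    rw [neg_one_smul, sub_eq_add_neg]

/-- Cayley–Hamilton reduces a power of `a` to a combination of `a` and 1, which are linearly
independent; the cube below is treated in the same way. -/
theorem det_eq_of_mul_self (ha : ¬ IsScalar a) {c : ℂ} (h : a * a = c • 1) :
    a.trace = 0 ∧ a.det = -c := by
  rw [mul_self_eq, sub_eq_iff_eq_add, ← add_smul] at h
  obtain ⟨h1, h2⟩ := eq_zero_of_smul_eq_smul_one ha h
  exact ⟨h1, by linear_combination h2⟩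

theorem trace_sq_of_cube (ha : ¬ IsScalar a) {c : ℂ} (h : a * a * a = c • 1) :
    a.trace ^ 2 = a.det ∧ c = -(a.trace * a.det) := by
  have h1 : (a.trace ^ 2 - a.det) • a = (c + a.trace * a.det) • (1 : Matrix (Fin 2) (Fin 2) ℂ) := by
    rw [mul_self_eq, sub_mul, smul_mul_assoc, mul_self_eq, smul_mul_assoc, one_mul] at h
    rw [add_smul, ← h, smul_sub, smul_smul, smul_smul, sub_smul, pow_two]
    abel
  obtain ⟨h2, h3⟩ := eq_zero_of_smul_eq_smul_one ha h1
  exact ⟨by linear_combination h2, by linear_combination h3⟩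

end Matrices

/-! ### Counting conjugates -/

open Classical in
/-- If `M` contains every element that conjugates some element of `T \ Z` into `T`, then
the conjugates of `T \ Z` are many. -/
theorem card_conjugates {K : Type*} [Group K] [Fintype K] (T Z : Subgroup K) (hZT : Z ≤ T)
    (M : Finset K) (hM : ∀ t ∈ T, t ∉ Z → ∀ x, x * t * x⁻¹ ∈ T → x ∈ M) :
    Nat.card K * (Nat.card T - Nat.card Z) ≤
      M.card * (Finset.univ.filter fun y => ∃ t ∈ T, t ∉ Z ∧ ∃ x : K, x * t * x⁻¹ = y).card := by
  set D : Finset K := Finset.univ.filter fun t => t ∈ T ∧ t ∉ Z with hD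
  have hcard : D.card = Nat.card T - Nat.card Z := by
    have e : D = (Finset.univ.filter (· ∈ T)) \ (Finset.univ.filter (· ∈ Z)) := by
      ext t; simp [hD]
    rw [e, Finset.card_sdiff_of_subset (fun t => by simpa using fun h => hZT h)]
    simp [Nat.card_eq_fintype_card, Fintype.card_subtype]
  rw [← hcard, Nat.card_eq_fintype_card, ← Finset.card_univ, ← Finset.card_product]
  refine (Finset.card_le_mul_card_image (f := fun p : K × K => p.1 * p.2 * p.1⁻¹) _ M.card ?_).trans
    (Nat.mul_le_mul_left _ (Finset.card_le_card ?_))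
  · rintro _ hy
    obtain ⟨⟨x₀, t₀⟩, h₀, rfl⟩ := Finset.mem_image.1 hy
    have ht₀ : t₀ ∈ T ∧ t₀ ∉ Z := by simpa [hD] using h₀
    -- Two pairs in one fibre of (x, t) ↦ x t x⁻¹ differ by an element conjugating t into T, so the
    -- fibre embeds in `M`; within a fibre x determines t.
    refine Finset.card_le_card_of_injOn (fun p => x₀⁻¹ * p.1) ?_ ?_
    · rintro ⟨x, t⟩ hp
      have hp' : (t ∈ T ∧ t ∉ Z) ∧ x * t * x⁻¹ = x₀ * t₀ * x₀⁻¹ := by simpa [hD] using hp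
      refine hM t hp'.1.1 hp'.1.2 _ ?_
      have : x₀⁻¹ * x * t * (x₀⁻¹ * x)⁻¹ = x₀⁻¹ * (x * t * x⁻¹) * x₀ := by group
      rw [this, hp'.2]
      simpa [mul_assoc] using ht₀.1
    · rintro ⟨x, t⟩ hp ⟨x', t'⟩ hp' h
      have h1 : x * t * x⁻¹ = x₀ * t₀ * x₀⁻¹ := by
        have : (t ∈ T ∧ t ∉ Z) ∧ x * t * x⁻¹ = x₀ * t₀ * x₀⁻¹ := by simpa [hD] using hp
        exact this.2
      have h2 : x' * t' * x'⁻¹ = x₀ * t₀ * x₀⁻¹ := by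
        have : (t' ∈ T ∧ t' ∉ Z) ∧ x' * t' * x'⁻¹ = x₀ * t₀ * x₀⁻¹ := by simpa [hD] using hp'
        exact this.2
      obtain rfl : x = x' := mul_left_cancel h
      rw [← h2] at h1
      rw [mul_left_cancel (mul_right_cancel h1)]
  · intro y hy
    obtain ⟨⟨x, t⟩, h, rfl⟩ := Finset.mem_image.1 hy
    have ht : t ∈ T ∧ t ∉ Z := by simpa [hD] using h
    simp only [Finset.mem_filter, Finset.mem_univ, true_and]
    exact ⟨t, ht.1, ht.2, x, rfl⟩

/-- At least r/(r+1) of T lies outside Z, and each conjugate is hit at most m|T| times, so the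
conjugates fill at least r/((r+1)m) of K. -/
theorem mul_card_le_card_conjugates {K : Type*} [Group K] [Fintype K] {T Z : Subgroup K}
    (hZT : Z ≤ T) {r m : ℕ} (hr : (r + 1) * Nat.card Z ≤ Nat.card T) {M : Finset K}
    (hMT : M.card ≤ m * Nat.card T)
    (hM : ∀ t ∈ T, t ∉ Z → ∀ x, x * t * x⁻¹ ∈ T → x ∈ M) {A : Finset K}
    (hA : ∀ t ∈ T, t ∉ Z → ∀ x : K, x * t * x⁻¹ ∈ A) :
    r * Nat.card K ≤ (r + 1) * m * A.card := by
  classical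
  have h1 := card_conjugates T Z hZT M hM
  have h2 : (Finset.univ.filter fun y => ∃ t ∈ T, t ∉ Z ∧ ∃ x : K, x * t * x⁻¹ = y) ⊆ A := by
    intro y hy
    obtain ⟨t, ht, htZ, x, rfl⟩ := (Finset.mem_filter.1 hy).2
    exact hA t ht htZ x
  have h3 : Nat.card K * (Nat.card T - Nat.card Z) ≤ m * Nat.card T * A.card :=
    h1.trans (by convert Nat.mul_le_mul hMT (Finset.card_le_card h2))
  refine Nat.le_of_mul_le_mul_left (?_ : Nat.card T * _ ≤ Nat.card T * _) Nat.card_pos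
  have h4 : r * Nat.card T ≤ (r + 1) * (Nat.card T - Nat.card Z) := by
    rw [Nat.mul_sub, add_mul, one_mul]
    omega
  calc _ = Nat.card K * (r * Nat.card T) := by ring
    _ ≤ Nat.card K * ((r + 1) * (Nat.card T - Nat.card Z)) := Nat.mul_le_mul_left _ h4
    _ = (r + 1) * (Nat.card K * (Nat.card T - Nat.card Z)) := by ring
    _ ≤ (r + 1) * (m * Nat.card T * A.card) := Nat.mul_le_mul_left _ h3
    _ = _ := by ring

/-- The power of x with exponent [H : Z] lies in Z, so this index exceeds r. -/
theorem mul_card_le_of_pow_notMem {K : Type*} [Group K] [Finite K] {H Z : Subgroup K} [Z.Normal]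
    (hZH : Z ≤ H) {x : K} (hx : x ∈ H) {r : ℕ} (hr : ∀ n, n ≠ 0 → n ≤ r → x ^ n ∉ Z) :
    (r + 1) * Nat.card Z ≤ Nat.card H := by
  have h1 : Nat.card Z * (Z.subgroupOf H).index = Nat.card H := by
    rw [← (Z.subgroupOf H).card_mul_index, Nat.card_congr (Subgroup.subgroupOfEquivOfLe hZH).toEquiv]
  rw [← h1, mul_comm]
  refine Nat.mul_le_mul_left _ ?_
  by_contra h
  have h2 := Subgroup.pow_index_mem (Z.subgroupOf H) (⟨x, hx⟩ : H)
  exact hr _ Subgroup.index_ne_zero_of_finite (by omega) h2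

/-! ### Centralizers in small groups -/

section Group

variable {K : Type*} [Group K] (ρ : K →* Matrix (Fin 2) (Fin 2) ℂ)

/-- A nonscalar square root of 1 has eigenvalues 1 and −1, and the eigenvalue 1 is reserved for the
identity; a nonscalar square root of −1 has eigenvalues ±i. -/
theorem det_eq_one_of_mul_self (hs : ∀ k, (ρ k - 1).det = 0 → k = 1) {w : K}
    (hw : ¬ IsScalar (ρ w)) (h : ρ (w * w) = 1 ∨ ρ (w * w) = -1) : (ρ w).det = 1 := by
  rw [map_mul] at h
  rcases h with h | h
  · obtain ⟨h1, h2⟩ := det_eq_of_mul_self hw (c := 1) (by rw [h, one_smul])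
    obtain rfl : w = 1 := hs w (by rw [det_sub_one_eq, h1, h2]; ring)
    rw [map_one, det_one]
  · obtain ⟨-, h2⟩ := det_eq_of_mul_self hw (c := -1) (by rw [h, neg_one_smul])
    rw [h2, neg_neg]

/-- The eigenvalues are distinct cube roots of 1, or of −1. The real root is excluded, so they are
complex conjugate of modulus 1 and their product is 1. -/
theorem det_eq_one_of_cube (hs : ∀ k, (ρ k - 1).det = 0 → k = 1) {w : K}
    (hw : ¬ IsScalar (ρ w)) (h : ρ (w ^ 3) = 1 ∨ ρ (w ^ 3) = -1) : (ρ w).det = 1 := by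
  have hw1 : w ≠ 1 := by
    rintro rfl
    exact hw ⟨1, by rw [map_one, one_smul]⟩
  have h3 : ρ (w ^ 3) = ρ w * ρ w * ρ w := by rw [map_pow, pow_succ, pow_two]
  rcases h with h | h
  · obtain ⟨h1, h2⟩ := trace_sq_of_cube hw (c := 1) (by rw [← h3, h, one_smul])
    have hd : (ρ w - 1).det ≠ 0 := fun h0 => hw1 (hs w h0)
    rw [det_sub_one_eq, ← h1] at hd
    rw [← h1] at h2 ⊢
    have ht : (ρ w).trace + 1 = 0 := by
      refine (mul_eq_zero.1 (?_ : _ * (1 - (ρ w).trace + (ρ w).trace ^ 2) = 0)).resolve_right hd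
      linear_combination h2
    rw [eq_neg_of_add_eq_zero_left ht]
    norm_num
  · obtain ⟨h1, h2⟩ := trace_sq_of_cube hw (c := -1) (by rw [← h3, h, neg_one_smul])
    have h4 : ρ (w ^ 4) = -ρ w := by rw [pow_succ, map_mul, h, neg_one_mul]
    -- An eigenvalue −1 of w is an eigenvalue 1 of w⁴ = −w, forcing w⁴ = 1 and w to act as the
    -- scalar −1.
    have hd : (ρ w + 1).det ≠ 0 := by
      intro h0
      have : w ^ 4 = 1 := hs _ (by rw [h4, ← neg_add', det_neg, h0, mul_zero])
      rw [this, map_one] at h4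
      exact hw ⟨-1, by rw [neg_one_smul, h4, neg_neg]⟩
    rw [det_add_one_eq, ← h1] at hd
    rw [← h1] at h2 ⊢
    have ht : (ρ w).trace - 1 = 0 := by
      refine (mul_eq_zero.1 (?_ : _ * (1 + (ρ w).trace + (ρ w).trace ^ 2) = 0)).resolve_right hd
      linear_combination h2
    rw [sub_eq_zero.1 ht, one_pow]

/-- In a finite group acting on `ℂ²` such that only the identity has the eigenvalue `1`, and not
contained in `SL₂(ℂ)`, no centralizer is contained in `SL₂(ℂ)`. -/
theorem exists_commute_det_ne_one [Finite K] (hinj : Function.Injective ρ)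
    (hs : ∀ k, (ρ k - 1).det = 0 → k = 1) {k₀ : K} (hk₀ : (ρ k₀).det ≠ 1) (g : K) :
    ∃ h, Commute h g ∧ (ρ h).det ≠ 1 := by
  classical
  by_contra hcon
  have hC : ∀ h, Commute h g → (ρ h).det = 1 := fun h hh => by
    by_contra h1
    exact hcon ⟨h, hh, h1⟩
  have := Fintype.ofFinite K
  have comm_iff : ∀ {x y : K}, Commute (ρ x) (ρ y) ↔ Commute x y := fun {x y} =>
    ⟨fun h => hinj (by rw [map_mul, map_mul]; exact h), fun h => h.map ρ⟩
  have hnc : ¬ Commute k₀ g := fun h => hk₀ (hC k₀ h)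
  set Z := Subgroup.center K with hZ
  have hZ_comm : ∀ {z}, z ∈ Z → ∀ x, Commute z x := fun {z} hz x =>
    (Subgroup.mem_center_iff.1 hz x).symm
  have hscal : ∀ {z}, IsScalar (ρ z) ↔ z ∈ Z := by
    intro z
    constructor
    · rintro ⟨c, hc⟩
      refine Subgroup.mem_center_iff.2 fun x => ?_
      refine (comm_iff.1 ?_ : Commute x z)
      rw [hc]
      exact (Commute.one_right _).smul_right c
    · intro hz
      -- A nonscalar central element would commute with both k₀ and g, making these commute with
      -- each other.
      by_contra h
      exact hnc (comm_iff.1 (commute_of_commute h (comm_iff.2 (hZ_comm hz k₀))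
        (comm_iff.2 (hZ_comm hz g))))
  have hZ1 : ∀ {z}, z ∈ Z → ρ z = 1 ∨ ρ z = -1 := by
    intro z hz
    obtain ⟨c, hc⟩ := hscal.2 hz
    have hd := hC z (hZ_comm hz g)
    rw [hc, det_smul, det_one, Fintype.card_fin, mul_one, sq_eq_one_iff] at hd
    rcases hd with rfl | rfl
    · left; rw [hc, one_smul]
    · right; rw [hc, neg_one_smul]
  have hns : ∀ {z}, z ∉ Z → ¬ IsScalar (ρ z) := fun hz h => hz (hscal.1 h)
  have htrans : ∀ {a b c}, a ∉ Z → Commute a b → Commute a c → Commute b c :=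
    fun ha hb hc => comm_iff.1 (commute_of_commute (hns ha) (comm_iff.2 hb) (comm_iff.2 hc))
  have hk₀Z : k₀ ∉ Z := fun h => hnc (hZ_comm h g)
  have hgZ : g ∉ Z := fun h => hnc (hZ_comm h k₀).symm
  -- A conjugate of t that commutes with t is t itself or t with its eigenvalues exchanged.
  have hconj : ∀ {t x}, t ∉ Z → Commute t (x * t * x⁻¹) →
      Commute x t ∨ ρ (x * t * x⁻¹) = (ρ t).trace • 1 - ρ t := by
    intro t x ht h
    have hu : ρ x⁻¹ * ρ x = 1 := by rw [← map_mul, inv_mul_cancel, map_one]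
    have htr : (ρ (x * t * x⁻¹)).trace = (ρ t).trace := by
      rw [map_mul, trace_mul_comm, map_mul, ← mul_assoc, hu, one_mul]
    have hdet : (ρ (x * t * x⁻¹)).det = (ρ t).det := by
      rw [map_mul, det_mul_comm, map_mul, ← mul_assoc, hu, one_mul]
    have hdisc := disc_ne_zero (hns ht) (n := Nat.card K) Nat.card_pos.ne'
      (by rw [← map_pow, pow_card_eq_one', map_one])
    refine (eq_or_eq_of_commute (hns ht) hdisc (comm_iff.2 h) htr hdet).imp_left fun h => ?_
    have := hinj h
    exact mul_inv_eq_iff_eq_mul.1 this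
  -- If x exchanges the eigenvalues of t, then x² commutes with t. Were x² not central, transitivity
  -- would make x commute with t; so x² acts by ±1.
  have hswap : ∀ {t x}, t ∉ Z → ¬ Commute x t → Commute t (x * t * x⁻¹) → (ρ x).det = 1 := by
    intro t x ht hx h
    have h1 := (hconj ht h).resolve_left hx
    have h2 : Commute (x * x) t := by
      have hxx : ρ x * ρ x⁻¹ = 1 := by rw [← map_mul, mul_inv_cancel, map_one]
      have : ρ (x * (x * t * x⁻¹) * x⁻¹) = ρ t := by
        rw [map_mul, map_mul, h1, mul_sub, sub_mul, mul_smul_comm, smul_mul_assoc, mul_one, hxx,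
          ← map_mul, ← map_mul, h1, sub_sub_cancel]
      have h3 := hinj this
      have h4 : x * (x * t * x⁻¹) * x⁻¹ = x * x * t * (x * x)⁻¹ := by group
      rw [h4] at h3
      exact mul_inv_eq_iff_eq_mul.1 h3
    have hxZ : x ∉ Z := fun h => hx (hZ_comm h t)
    by_cases h3 : x * x ∈ Z
    · exact det_eq_one_of_mul_self ρ hs (hns hxZ) (hZ1 h3)
    · exact absurd (htrans h3 ((Commute.refl x).mul_left (Commute.refl x)) h2) hx
  set T := Subgroup.centralizer {k₀} with hT
  set C := Subgroup.centralizer {g} with hCdef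
  have memT : ∀ {x}, x ∈ T ↔ Commute k₀ x := fun {x} =>
    Subgroup.mem_centralizer_singleton_iff.trans eq_comm
  have memC : ∀ {x}, x ∈ C ↔ Commute g x := fun {x} =>
    Subgroup.mem_centralizer_singleton_iff.trans eq_comm
  have hZT : Z ≤ T := Subgroup.center_le_centralizer _
  have hZC : Z ≤ C := Subgroup.center_le_centralizer _
  -- T is self-normalizing: if x ∉ T moved t into T, both x and k₀x would exchange the eigenvalues
  -- of t, hence have determinant 1, and so would k₀.
  have hTself : ∀ t ∈ T, t ∉ Z → ∀ x, x * t * x⁻¹ ∈ T →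
      x ∈ Finset.univ.filter (· ∈ T) := by
    intro t ht htZ x hx
    simp only [Finset.mem_filter, Finset.mem_univ, true_and]
    by_contra hxT
    have hxt : ¬ Commute x t := fun h => hxT (memT.2 (htrans htZ (memT.1 ht).symm h.symm))
    have h1 := hswap htZ hxt (htrans hk₀Z (memT.1 ht) (memT.1 hx))
    have h2 : ¬ Commute (k₀ * x) t := fun h => hxt (by
      have := (memT.1 ht).inv_left.mul_left h
      rwa [inv_mul_cancel_left] at this)
    have h3 : k₀ * x * t * (k₀ * x)⁻¹ = x * t * x⁻¹ := by
      have : k₀ * x * t * (k₀ * x)⁻¹ = k₀ * (x * t * x⁻¹) * k₀⁻¹ := by group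
      rw [this]
      exact mul_inv_eq_of_eq_mul (memT.1 hx)
    have h4 := hswap htZ h2 (by rw [h3]; exact htrans hk₀Z (memT.1 ht) (memT.1 hx))
    rw [map_mul, det_mul, h1, mul_one] at h4
    exact hk₀ h4
  -- For C an exchange is possible, but the elements exchanging the eigenvalues of g form at most
  -- one coset wC, which accounts for the factor 2.
  have hCself : ∃ M : Finset K, M.card ≤ 2 * Nat.card C ∧
      ∀ t ∈ C, t ∉ Z → ∀ x, x * t * x⁻¹ ∈ C → x ∈ M := by
    have hnorm : ∀ t ∈ C, t ∉ Z → ∀ x, x * t * x⁻¹ ∈ C →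
        x ∈ C ∨ ρ (x * g * x⁻¹) = (ρ g).trace • 1 - ρ g := by
      intro t ht htZ x hx
      have h1 : x * t * x⁻¹ ∉ Z := fun h => htZ (by
        have := (inferInstance : (Subgroup.center K).Normal).conj_mem _ h x⁻¹
        simpa [mul_assoc] using this)
      have h2 : Commute (x * t * x⁻¹) (x * g * x⁻¹) := by
        have := (memC.1 ht).symm.map (MulAut.conj x)
        simpa using this
      exact (hconj hgZ (htrans h1 (memC.1 hx).symm h2)).imp_left fun h => memC.2 h.symm
    have hcardC : (Finset.univ.filter (· ∈ C)).card = Nat.card C := by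
      simp [Nat.card_eq_fintype_card, Fintype.card_subtype]
    by_cases hw : ∃ w, ρ (w * g * w⁻¹) = (ρ g).trace • 1 - ρ g
    · obtain ⟨w, hw⟩ := hw
      refine ⟨Finset.univ.filter (· ∈ C) ∪ (Finset.univ.filter (· ∈ C)).image (w * ·), ?_, ?_⟩
      · refine (Finset.card_union_le _ _).trans ?_
        have := Finset.card_image_le (s := Finset.univ.filter (· ∈ C)) (f := (w * ·))
        omega
      · intro t ht htZ x hx
        rw [Finset.mem_union]
        refine (hnorm t ht htZ x hx).imp (fun h => by simpa using h) fun h => ?_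
        refine Finset.mem_image.2 ⟨w⁻¹ * x, ?_, mul_inv_cancel_left w x⟩
        have h1 : x * g * x⁻¹ = w * g * w⁻¹ := hinj (h.trans hw.symm)
        have h2 : w⁻¹ * x * g * (w⁻¹ * x)⁻¹ = g := by
          have : w⁻¹ * x * g * (w⁻¹ * x)⁻¹ = w⁻¹ * (x * g * x⁻¹) * w := by group
          rw [this, h1]
          group
        simp only [Finset.mem_filter, Finset.mem_univ, true_and]
        exact memC.2 (mul_inv_eq_iff_eq_mul.1 h2).symm
    · refine ⟨Finset.univ.filter (· ∈ C), by omega, fun t ht htZ x hx => ?_⟩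
      have := (hnorm t ht htZ x hx).resolve_right fun h => hw ⟨x, h⟩
      simpa using this
  obtain ⟨M, hMcard, hM⟩ := hCself
  have hCz : (1 + 1) * Nat.card Z ≤ Nat.card C :=
    mul_card_le_of_pow_notMem hZC (memC.2 (Commute.refl g)) fun n h0 h1 => by
      rwa [show n = 1 by omega, pow_one]
  -- None of k₀, k₀², k₀³ is central, since k₀ is not and a central square or cube would give det k₀
  -- = 1.
  have hTz : (3 + 1) * Nat.card Z ≤ Nat.card T := by
    refine mul_card_le_of_pow_notMem hZT (memT.2 (Commute.refl k₀)) fun n h0 h1 h => ?_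
    have h2 : n = 1 ∨ n = 2 ∨ n = 3 := by omega
    rcases h2 with rfl | rfl | rfl
    · exact hk₀Z (by rwa [pow_one] at h)
    · exact hk₀ (det_eq_one_of_mul_self ρ hs (hns hk₀Z) (by rw [← pow_two]; exact hZ1 h))
    · exact hk₀ (det_eq_one_of_cube ρ hs (hns hk₀Z) (hZ1 h))
  set A := Finset.univ.filter fun y => ∃ t ∈ T, t ∉ Z ∧ ∃ x : K, x * t * x⁻¹ = y with hAdef
  set B := Finset.univ.filter fun y => ∃ t ∈ C, t ∉ Z ∧ ∃ x : K, x * t * x⁻¹ = y with hBdef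
  -- A common element would yield a conjugate of k₀ commuting with g, hence det k₀ = 1.
  have hdisj : Disjoint A B := by
    rw [Finset.disjoint_left]
    rintro y hyA hyB
    obtain ⟨t, ht, htZ, x, rfl⟩ := (Finset.mem_filter.1 hyA).2
    obtain ⟨c, hc, hcZ, x', h⟩ := (Finset.mem_filter.1 hyB).2
    set u := x'⁻¹ * x with hu
    have h1 : u * t * u⁻¹ = c := by
      have : u * t * u⁻¹ = x'⁻¹ * (x * t * x⁻¹) * x' := by rw [hu]; group
      rw [this, ← h]
      group
    have h2 : Commute (u * t * u⁻¹) (u * k₀ * u⁻¹) := by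
      have := (memT.1 ht).symm.map (MulAut.conj u)
      simpa using this
    rw [h1] at h2
    have h3 := hC _ (htrans hcZ h2 (memC.1 hc).symm)
    refine hk₀ ?_
    rwa [map_mul, det_mul_comm, ← map_mul, inv_mul_cancel_left] at h3
  have hone : (1 : K) ∉ A ∪ B := by
    intro h
    rcases Finset.mem_union.1 h with h | h
    · obtain ⟨t, -, htZ, x, h1⟩ := (Finset.mem_filter.1 h).2
      rw [conj_eq_one_iff] at h1
      exact htZ (h1 ▸ one_mem Z)
    · obtain ⟨t, -, htZ, x, h1⟩ := (Finset.mem_filter.1 h).2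
      rw [conj_eq_one_iff] at h1
      exact htZ (h1 ▸ one_mem Z)
  have hsum : A.card + B.card < Nat.card K := by
    rw [← Finset.card_union_of_disjoint hdisj, Nat.card_eq_fintype_card]
    exact Finset.card_lt_univ_of_notMem hone
  have hTcard : (Finset.univ.filter (· ∈ T)).card ≤ 1 * Nat.card T := by
    simp [Nat.card_eq_fintype_card, Fintype.card_subtype]
  -- With (r, m) = (3, 1) and (1, 2) the bounds are 3|K| ≤ 4|A| and |K| ≤ 4|B|, against |A| + |B| <
  -- |K|.
  have hA := mul_card_le_card_conjugates hZT hTz hTcard hTself (A := A) fun t ht htZ x =>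
    Finset.mem_filter.2 ⟨Finset.mem_univ _, t, ht, htZ, x, rfl⟩
  have hB := mul_card_le_card_conjugates hZC hCz hMcard hM (A := B) fun t ht htZ x =>
    Finset.mem_filter.2 ⟨Finset.mem_univ _, t, ht, htZ, x, rfl⟩
  clear_value A B
  omega

end Group

end SmallGroup

/-! ### Subspaces of PBW type in degrees below N -/

namespace BimoduleTensor

variable {k S E : Type*} [Field k] [Ring S] [Algebra k S] [AddCommGroup E] [Module k E]
  [Module S E] [Module Sᵐᵒᵖ E]

/-- The homogeneous components of degree less than `N` of the ideal generated by a space of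
elements of degree `N` vanish. -/
theorem proj_ideal_eq_zero {N n : ℕ} (hn : n < N) {R : Submodule k (T k S E)}
    (hR : R ≤ deg k S E N) {x : T k S E} (hx : x ∈ ideal R) :
    GradedAlgebra.proj (deg k S E) n x = 0 := by
  have h : ideal R ≤ ⨆ i, ⨆ j, deg k S E i * R * deg k S E j := by
    refine (mul_le_mul' (mul_le_mul' le_iSup_deg le_rfl) le_iSup_deg).trans ?_
    simp only [Submodule.iSup_mul, Submodule.mul_iSup]
    exact le_of_eq iSup_comm
  have h2 : ⨆ i, ⨆ j, deg k S E i * R * deg k S E j ≤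
      LinearMap.ker (GradedAlgebra.proj (deg k S E) n) := by
    refine iSup₂_le fun i j y hy => ?_
    have hd : y ∈ deg k S E (i + N + j) := by
      refine (?_ : deg k S E i * R * deg k S E j ≤ deg k S E (i + N + j)) hy
      refine Submodule.mul_le.2 fun u hu b hb => SetLike.mul_mem_graded ?_ hb
      exact (Submodule.mul_le.2 fun a ha r hr => SetLike.mul_mem_graded ha (hR hr)) hu
    exact proj_of_mem_ne (by omega) hd
  exact h2 (h hx)

theorem eq_zero_of_proj {x : T k S E} (h : ∀ n, GradedAlgebra.proj (deg k S E) n x = 0) :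
    x = 0 := by
  have : DirectSum.decompose (deg k S E) x = 0 := by
    ext n
    exact h n
  exact (DirectSum.decompose (deg k S E)).injective (this.trans (DirectSum.decompose_zero _).symm)

theorem proj_filtPred_of_le {n m : ℕ} (hm : n ≤ m) {x : T k S E} (hx : x ∈ filtPred k S E n) :
    GradedAlgebra.proj (deg k S E) m x = 0 := by
  have : filtPred k S E n ≤ LinearMap.ker (GradedAlgebra.proj (deg k S E) m) :=
    iSup₂_le fun i hi y hy => proj_of_mem_ne (hi.trans_le hm).ne hy
  exact this hx

theorem eq_zero_of_mem_ideal_of_mem_filtPred {N : ℕ} {R : Submodule k (T k S E)}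
    (hR : R ≤ deg k S E N) {x : T k S E} (hx : x ∈ ideal R) (hx' : x ∈ filtPred k S E N) :
    x = 0 :=
  eq_zero_of_proj fun n => (lt_or_ge n N).elim (fun h => proj_ideal_eq_zero h hR hx)
    fun h => proj_filtPred_of_le h hx'

theorem le_ideal (P : Submodule k (T k S E)) : P ≤ ideal P := fun p hp => by
  have := Submodule.mul_mem_mul (Submodule.mul_mem_mul
    (Submodule.mem_top (x := (1 : T k S E)) (R := k)) hp)
    (Submodule.mem_top (x := (1 : T k S E)) (R := k))
  rwa [one_mul, mul_one] at this

/-- The injectivity half of `induces_iso`, read on leading terms: that of an element of I(P) lies in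
I(R). -/
theorem IsPBWType.mem_ideal {N n : ℕ} {R P : Submodule k (T k S E)} (h : IsPBWType N R P)
    {x : T k S E} (hx : x ∈ deg k S E n) {u : T k S E} (hu : u ∈ filtPred k S E n)
    (hxu : x - u ∈ ideal P) : x ∈ ideal R := by
  obtain ⟨e, he⟩ := h.induces_iso n
  have h1 : toGr P n ⟨x, hx⟩ = 0 := toGr_eq_zero.2 ⟨u, hu, hxu⟩
  rw [← he, LinearEquiv.map_eq_zero_iff, Submodule.Quotient.mk_eq_zero] at h1
  exact h1

theorem filtPred_succ_le (n : ℕ) :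
    filtPred k S E (n + 1) ≤ deg k S E n ⊔ filtPred k S E n :=
  (iSup₂_le fun i hi => le_iSup₂_of_le (f := fun i (_ : i ≤ n) => deg k S E i) i
    (Nat.lt_succ_iff.1 hi) le_rfl : filtPred k S E (n + 1) ≤ filt k S E n).trans (filt_le n)

/-- A subspace of PBW type contains no elements of degree less than `N`. -/
theorem IsPBWType.eq_zero {N : ℕ} {R P : Submodule k (T k S E)} (h : IsPBWType N R P)
    (hR : R ≤ deg k S E N) {x : T k S E} (hx : x ∈ ideal P) (hx' : x ∈ filtPred k S E N) :
    x = 0 := by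
  -- `filtPred n` is F^{n−1}, so n = 0 is the zero space. In the induction the leading term lies in
  -- I(R), which vanishes below degree N, so the degree drops.
  have key : ∀ n ≤ N, ∀ x ∈ ideal P, x ∈ filtPred k S E n → x = 0 := by
    intro n
    induction n with
    | zero =>
      intro _ x _ h0
      simpa [filtPred] using h0
    | succ n ih =>
      intro hn x hx h1
      obtain ⟨t, ht, u, hu, rfl⟩ := Submodule.mem_sup.1 (filtPred_succ_le n h1)
      have h2 : t ∈ ideal R := h.mem_ideal ht (neg_mem hu) (by rwa [sub_neg_eq_add])
      have h3 : t = 0 := eq_zero_of_mem_ideal_of_mem_filtPred hR h2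
        (mem_filtPred_of_mem (by omega) ht)
      rw [h3, zero_add] at hx ⊢
      exact ih (by omega) u hx hu
  exact key N le_rfl x hx hx'

theorem mem_filtPred_two {x : T k S E} (hx : x ∈ filtPred k S E 2) :
    ∃ s e, x = ofBase k S E s + ofMod k S E e := by
  obtain ⟨t, ht, u, hu, rfl⟩ := Submodule.mem_sup.1 (filtPred_succ_le 1 hx)
  obtain ⟨v, hv, w, hw, rfl⟩ := Submodule.mem_sup.1 (filtPred_succ_le 0 hu)
  have hw0 : w = 0 := by simpa [filtPred] using hw
  obtain ⟨s, rfl⟩ : v ∈ LinearMap.range (ofBase k S E).toLinearMap := by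
    simpa [deg] using hv
  have ht' : t ∈ LinearMap.range (ofMod k S E) := by
    refine (?_ : deg k S E 1 ≤ LinearMap.range (ofMod k S E)) ht
    rw [deg, pow_one]
    refine Submodule.mul_le.2 ?_
    rintro _ ⟨s, rfl⟩ _ ⟨e, rfl⟩
    exact ⟨s • e, ofMod_smul s e⟩
  obtain ⟨e, rfl⟩ := ht'
  exact ⟨s, e, by rw [hw0, add_zero, add_comm]; rfl⟩

end BimoduleTensor

/-! ### Small groups, coefficients in the skew group algebra, and rigidity -/

namespace SkewGL
open Matrix

variable (G : Subgroup (GL (Fin 2) ℂ))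

/-- The matrix of an element of `G`. -/
noncomputable def toMat : G →* Matrix (Fin 2) (Fin 2) ℂ :=
  (Units.coeHom (Matrix (Fin 2) (Fin 2) ℂ)).comp G.subtype

theorem toMat_injective : Function.Injective (toMat G) := fun _ _ h =>
  Subtype.ext (Units.ext h)

variable {G}

theorem dual_apply_apply (g : G) (f : Form) (v : Fin 2 → ℂ) :
    (natRep G).dual g f v = f (toMat G g⁻¹ *ᵥ v) := rfl

theorem form_eq (f : Form) : f = f (Pi.single 0 1) • (LinearMap.proj 0 : Form) +
    f (Pi.single 1 1) • (LinearMap.proj 1 : Form) := by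
  refine LinearMap.pi_ext' fun i => LinearMap.ext_ring ?_
  fin_cases i <;> simp

theorem det_toMat_inv_mul (g : G) : (toMat G g⁻¹).det * (toMat G g).det = 1 := by
  rw [← det_mul, ← map_mul, inv_mul_cancel, map_one, det_one]

/-- A singular 2 × 2 matrix has rank 0 or 1, and smallness excludes rank 1. -/
theorem IsSmall.eq_one (hsmall : IsSmall G) (g : G) (h : (toMat G g - 1).det = 0) : g = 1 := by
  by_contra hg
  refine hsmall g g.2 ?_
  have h0 : toMat G g - 1 ≠ 0 := fun h0 =>
    hg (toMat_injective G ((sub_eq_zero.1 h0).trans (map_one _).symm))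
  change (toMat G g - 1).rank = 1
  have h1 : (toMat G g - 1).rank ≠ 0 := by
    rw [Matrix.rank, ne_eq, Submodule.finrank_eq_zero, LinearMap.range_eq_bot, ← toLin'_apply']
    exact fun h1 => h0 (toLin'.map_eq_zero_iff.1 h1)
  have h2 : LinearMap.ker (toMat G g - 1).mulVecLin ≠ ⊥ := by
    obtain ⟨v, hv, hv'⟩ := exists_mulVec_eq_zero_iff.2 h
    exact (Submodule.ne_bot_iff _).2 ⟨v, hv', hv⟩
  have h3 := Submodule.one_le_finrank_iff.2 h2
  have h4 := (toMat G g - 1).mulVecLin.finrank_range_add_finrank_ker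
  rw [Module.finrank_fin_fun, ← Matrix.rank] at h4
  omega

/-- In a small group, only the identity acts on a nonzero linear form through the determinant. -/
theorem IsSmall.eq_one_of_dual_eq (hsmall : IsSmall G) {g : G} {f : Form} (hf : f ≠ 0)
    (h : (natRep G).dual g f = (toMat G g⁻¹).det • f) : g = 1 := by
  refine inv_eq_one.1 (hsmall.eq_one g⁻¹ ?_)
  set a := toMat G g⁻¹ with ha
  have hd : a.det ≠ 0 := left_ne_zero_of_mul_eq_one (det_toMat_inv_mul g)
  set w : Fin 2 → ℂ := fun i => f (Pi.single i 1) with hw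
  have hfw : ∀ v, f v = w ⬝ᵥ v := by
    intro v
    conv_lhs => rw [form_eq f]
    simp [dotProduct, hw]
  have hw0 : w ≠ 0 := fun h0 => hf (LinearMap.ext fun v => by rw [hfw, h0]; simp)
  -- In coordinates f is a left eigenvector of a = g⁻¹ with eigenvalue det a.
  have h1 : w ᵥ* (a - a.det • 1) = 0 := by
    rw [vecMul_sub, vecMul_smul, vecMul_one, sub_eq_zero]
    ext i
    have := LinearMap.congr_fun h (Pi.single i 1)
    rw [dual_apply_apply, hfw, dotProduct_mulVec] at this
    simpa [hfw] using this
  have h2 : (a - a.det • 1).det = 0 := exists_vecMul_eq_zero_iff.1 ⟨w, hw0, h1⟩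
  -- If one eigenvalue equals the product of both, and this is nonzero, the other is 1.
  have h3 : a.det * (a - 1).det = (a - a.det • 1).det := by
    simp [det_fin_two]
    ring
  rw [h2] at h3
  exact (mul_eq_zero.1 h3).resolve_left hd

/-- Evaluation of a polynomial function at a point. -/
noncomputable def evalAt (v : Fin 2 → ℂ) : Poly →ₐ[ℂ] ℂ :=
  SymmetricAlgebra.lift (Module.Dual.eval ℂ (Fin 2 → ℂ) v)

theorem evalAt_lin (v : Fin 2 → ℂ) (f : Form) : evalAt v (lin f) = f v :=
  SymmetricAlgebra.lift_ι_apply _ _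

/-- Separates the degree 0 and degree 1 equations on u. Evaluating at points suffices, the origin
giving the constant. -/
theorem algebraMap_add_lin_inj {c c' : ℂ} {f f' : Form}
    (h : algebraMap ℂ Poly c + lin f = algebraMap ℂ Poly c' + lin f') : c = c' ∧ f = f' := by
  have h1 : ∀ v, c + f v = c' + f' v := fun v => by
    have := congrArg (evalAt v) h
    simpa [evalAt_lin] using this
  have h2 : c = c' := by simpa using h1 0
  refine ⟨h2, LinearMap.ext fun v => ?_⟩
  have := h1 v
  rwa [h2, add_right_inj] at this

theorem coeff_groupIncl (a : MonoidAlgebra ℂ G) (g : G) :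
    (groupIncl G a).coeff g = algebraMap ℂ Poly (a.coeff g) := by
  classical
  induction a using MonoidAlgebra.induction_linear with
  | zero => simp
  | add x y hx hy =>
    rw [map_add, SkewMonoidAlgebra.coeff_add, Finsupp.add_apply, hx, hy, ← map_add]
    rfl
  | single h c =>
    rw [groupIncl_single, SkewMonoidAlgebra.coeff_smul, Finsupp.smul_apply,
      SkewMonoidAlgebra.coeff_single_apply, MonoidAlgebra.coeff_single, Finsupp.single_apply]
    split_ifs
    · rw [Algebra.algebraMap_eq_smul_one]
    · rw [smul_zero, map_zero]

/-- Since V is the sum of the spaces (ℂ²)* ⊗ g, its elements are families of linear forms indexed by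
G. -/
theorem coeff_genIncl (e : Gen G) : ∃ E : G → Form, ∀ g, (genIncl G e).coeff g = lin (E g) := by
  induction e using gen_induction with
  | h0 => exact ⟨0, fun g => by simp⟩
  | hg f a =>
    refine ⟨fun g => a.coeff g • f, fun g => ?_⟩
    rw [genIncl_gen, SkewMonoidAlgebra.coeff_single_one_mul, coeff_groupIncl, map_smul, mul_comm,
      Algebra.smul_def]
  | ha x y hx hy =>
    obtain ⟨E, hE⟩ := hx
    obtain ⟨E', hE'⟩ := hy
    exact ⟨E + E', fun g => by simp [hE, hE']⟩

theorem coeff_conj (q : SkewGroupAlgebra G) (h g : G) :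
    (SkewMonoidAlgebra.single h 1 * q * SkewMonoidAlgebra.single h⁻¹ 1).coeff (h * g * h⁻¹) =
      h • q.coeff g := by
  rw [SkewMonoidAlgebra.coeff_mul_single, SkewMonoidAlgebra.coeff_single_mul]
  simp

variable (G) in
/-- The commutator of the two coordinates. -/
noncomputable def coordComm : Tens G :=
  var G (LinearMap.proj 0) * var G (LinearMap.proj 1) -
    var G (LinearMap.proj 1) * var G (LinearMap.proj 0)

variable (G) in
/-- The inclusion of the linear forms into the tensor algebra, as a linear map. -/
noncomputable def varHom : Form →ₗ[ℂ] Tens G :=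
  BimoduleTensor.ofMod ℂ (MonoidAlgebra ℂ G) (Gen G) ∘ₗ
      (TensorProduct.mk ℂ Form (MonoidAlgebra ℂ G)).flip 1

theorem varHom_apply (f : Form) : varHom G f = var G f := rfl

/-- The commutator is alternating and (ℂ²)* is two-dimensional, so one commutator generates R as a
bimodule. -/
theorem commutator_eq (x y : Form) : var G x * var G y - var G y * var G x =
    (x (Pi.single 0 1) * y (Pi.single 1 1) - x (Pi.single 1 1) * y (Pi.single 0 1)) •
      coordComm G := by
  rw [form_eq x, form_eq y, coordComm]
  simp only [← varHom_apply, map_add, map_smul]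
  simp only [mul_add, add_mul, smul_mul_smul_comm]
  simp only [LinearMap.add_apply, LinearMap.smul_apply, LinearMap.proj_apply, Pi.single_eq_same,
    smul_eq_mul, mul_one, ne_eq, zero_ne_one, one_ne_zero, not_false_eq_true,
    Pi.single_eq_of_ne, mul_zero, add_zero, zero_add]
  module

/-- G acts on the exterior square of (ℂ²)* through the determinant of the dual representation, hence
the inverse. -/
theorem base_conj_coordComm (h : G) : base G (MonoidAlgebra.single h 1) * coordComm G *
    base G (MonoidAlgebra.single h⁻¹ 1) = (toMat G h⁻¹).det • coordComm G := by
  have h1 : base G (MonoidAlgebra.single h 1) * base G (MonoidAlgebra.single h⁻¹ 1) = 1 := by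
    rw [← map_mul, MonoidAlgebra.single_mul_single, mul_inv_cancel, mul_one,
      ← MonoidAlgebra.one_def, map_one]
  have h2 : base G (MonoidAlgebra.single h 1) * coordComm G =
      ((toMat G h⁻¹).det • coordComm G) * base G (MonoidAlgebra.single h 1) := by
    rw [coordComm, mul_sub, ← mul_assoc, ← mul_assoc, base_mul_var, base_mul_var, mul_assoc,
      mul_assoc, base_mul_var, base_mul_var, ← mul_assoc, ← mul_assoc, ← sub_mul, commutator_eq]
    simp only [dual_apply_apply, det_fin_two]
    simp [coordComm]
  rw [h2, mul_assoc, h1, mul_one]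

/-- A small subgroup of `GL₂(ℂ)` not contained in `SL₂(ℂ)` has only the trivial PBW
deformation. -/
theorem eq_relations_of_isPBWType [Finite G] (hsmall : IsSmall G)
    (hSL : ¬ G ≤ (Matrix.GeneralLinearGroup.det).ker) {P : Submodule ℂ (Tens G)}
    (hP : BimoduleTensor.IsPBWType 2 (relations G) P) : P = relations G := by
  have hR := relations_le_deg G
  obtain ⟨k₀, hk₀⟩ : ∃ k₀ : G, (toMat G k₀).det ≠ 1 := by
    by_contra hcon
    refine hSL fun g hg => ?_
    by_contra h
    refine hcon ⟨⟨g, hg⟩, fun h' => h ?_⟩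
    exact MonoidHom.mem_ker.2 (Units.ext h')
  have hzero : ∀ x ∈ P, x ∈ BimoduleTensor.filtPred ℂ (MonoidAlgebra ℂ G) (Gen G) 2 → x = 0 :=
    fun x hx hx' => hP.eq_zero hR (BimoduleTensor.le_ideal P hx) hx'
  have hsplit : ∀ p ∈ P, p - GradedAlgebra.proj
      (BimoduleTensor.deg ℂ (MonoidAlgebra ℂ G) (Gen G)) 2 p ∈
        BimoduleTensor.filtPred ℂ (MonoidAlgebra ℂ G) (Gen G) 2 := by
    intro p hp
    obtain ⟨t, ht, u, hu, rfl⟩ := Submodule.mem_sup.1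
      (BimoduleTensor.filt_le 2 (hP.le_filt hp))
    rwa [map_add, BimoduleTensor.proj_of_mem ht, BimoduleTensor.proj_filtPred hu, add_zero,
      add_sub_cancel_left]
  have hωR : coordComm G ∈ relations G :=
    Submodule.subset_span ⟨1, 1, _, _, by rw [map_one, one_mul, mul_one]; rfl⟩
  -- The lift p = ω + u of ω to P carries all the deformation data in u ∈ F^1.
  obtain ⟨p, hp, hpω⟩ := hP.map_proj.ge hωR
  have hu := hsplit p hp
  rw [hpω] at hu
  obtain ⟨u, hpu⟩ : ∃ u, u = p - coordComm G := ⟨_, rfl⟩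
  rw [← hpu] at hu
  obtain rfl : p = coordComm G + u := by rw [hpu]; abel
  obtain ⟨s, e, hse⟩ := BimoduleTensor.mem_filtPred_two hu
  obtain ⟨E, hE⟩ := coeff_genIncl e
  have hcoeff : ∀ g, (toSkew G u).coeff g = algebraMap ℂ Poly (s.coeff g) + lin (E g) := by
    intro g
    rw [hse, map_add, SkewMonoidAlgebra.coeff_add, Finsupp.add_apply, ← hE, ← coeff_groupIncl,
      ← toSkew_base]
    congr 2
    exact congrArg _ (BimoduleTensor.lift_ofMod _ _ _ _ e)
  -- h p h⁻¹ − det(h⁻¹) p lies in P, and its quadratic part cancels, so it lies in P ∩ F^1 = 0.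
  have hconj : ∀ h : G, base G (MonoidAlgebra.single h 1) * u *
      base G (MonoidAlgebra.single h⁻¹ 1) = (toMat G h⁻¹).det • u := by
    intro h
    have hmem := (hP.isSubbimodule (MonoidAlgebra.single h⁻¹ 1) _
      (hP.isSubbimodule (MonoidAlgebra.single h 1) _ hp).1).2
    rw [mul_add, add_mul] at hmem
    have hmem' := sub_mem hmem (P.smul_mem (toMat G h⁻¹).det hp)
    rw [smul_add, base_conj_coordComm, add_sub_add_left_eq_sub] at hmem'
    refine sub_eq_zero.1 (hzero _ hmem' (sub_mem ?_ (Submodule.smul_mem _ _ hu)))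
    rw [hse, mul_add, add_mul]
    refine add_mem (BimoduleTensor.mem_filtPred_of_mem (i := 0) (by norm_num) ?_)
      (BimoduleTensor.mem_filtPred_of_mem (i := 1) (by norm_num) ?_)
    · rw [← map_mul, ← map_mul]
      exact BimoduleTensor.ofBase_mem _ _ _ _
    · rw [← BimoduleTensor.ofMod_smul, ← BimoduleTensor.ofMod_op_smul]
      exact BimoduleTensor.ofMod_mem _ _ _ _
  have hkey : ∀ h g : G, s.coeff g = (toMat G h⁻¹).det * s.coeff (h * g * h⁻¹) ∧
      (natRep G).dual h (E g) = (toMat G h⁻¹).det • E (h * g * h⁻¹) := by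
    intro h g
    have h1 := congrArg (fun x => (toSkew G x).coeff (h * g * h⁻¹)) (hconj h)
    simp only [map_mul, map_smul] at h1
    rw [toSkew_base, toSkew_base, groupIncl_single, groupIncl_single, one_smul, one_smul,
      coeff_conj, hcoeff, SkewMonoidAlgebra.coeff_smul, Finsupp.smul_apply, hcoeff, smul_add,
      smul_add, smul_algebraMap, smul_lin, ← map_smul lin, Algebra.smul_def, ← map_mul] at h1
    exact algebraMap_add_lin_inj h1
  -- Conjugating by h = g forces g = 1; at g = 1, conjugating by k₀ forces k₀ = 1, against det k₀ ≠
  -- 1.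
  have hE0 : ∀ g, E g = 0 := by
    intro g
    by_contra h0
    have hg : g = 1 := hsmall.eq_one_of_dual_eq h0 (by simpa using (hkey g g).2)
    subst hg
    have hk : k₀ = 1 := hsmall.eq_one_of_dual_eq h0 (by simpa using (hkey k₀ 1).2)
    rw [hk, map_one, det_one] at hk₀
    exact hk₀ rfl
  have hs0 : ∀ g, s.coeff g = 0 := by
    intro g
    obtain ⟨h, hhg, hd⟩ := SmallGroup.exists_commute_det_ne_one (toMat G) (toMat_injective G)
      hsmall.eq_one hk₀ g
    have h1 := (hkey h g).1
    rw [hhg.eq, mul_inv_cancel_right] at h1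
    by_contra h0
    have h2 : (toMat G h⁻¹).det = 1 := mul_right_cancel₀ h0 (by rw [one_mul]; exact h1.symm)
    have h3 := det_toMat_inv_mul h
    rw [h2, one_mul] at h3
    exact hd h3
  -- All coefficients of the image of u vanish, so u ∈ I(R) by `ker_toSkew`; but I(R) has nothing in
  -- degrees below 2.
  have hu0 : u = 0 := by
    refine BimoduleTensor.eq_zero_of_mem_ideal_of_mem_filtPred hR ?_ hu
    rw [← ker_toSkew]
    refine SkewMonoidAlgebra.ext fun g => ?_
    change (toSkew G u).coeff g = _
    rw [hcoeff, hE0, hs0]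
    simp
  rw [hu0, add_zero] at hp
  have hle : relations G ≤ P := by
    refine Submodule.span_le.2 ?_
    rintro _ ⟨a, b, x, y, rfl⟩
    rw [commutator_eq]
    exact (hP.isSubbimodule b _ (hP.isSubbimodule a _ (P.smul_mem _ hp)).1).2
  -- An element of P and its quadratic part, which lies in R ⊆ P, differ by an element of P ∩ F^1 =
  -- 0.
  refine le_antisymm (fun x hx => ?_) hle
  have h1 : GradedAlgebra.proj (BimoduleTensor.deg ℂ (MonoidAlgebra ℂ G) (Gen G)) 2 x ∈
      relations G := hP.map_proj.le ⟨x, hx, rfl⟩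
  rw [sub_eq_zero.1 (hzero _ (sub_mem hx (hle h1)) (hsplit x hx))]
  exact h1

end SkewGL

theorem mainTheorem4 (G : Subgroup (Matrix.GeneralLinearGroup (Fin 2) ℂ)) [Finite G]
    (hsmall : SkewGL.IsSmall G) (hSL : ¬ G ≤ (Matrix.GeneralLinearGroup.det).ker) :
    (Function.Surjective (SkewGL.toSkew G) ∧
      LinearMap.ker (SkewGL.toSkew G).toLinearMap =
        BimoduleTensor.ideal (SkewGL.relations G)) ∧
    ∀ P : Submodule ℂ (SkewGL.Tens G),
      BimoduleTensor.IsPBWType 2 (SkewGL.relations G) P ↔ P = SkewGL.relations G := by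
  refine ⟨⟨SkewGL.toSkew_surjective G, SkewGL.ker_toSkew G⟩, fun P =>
    ⟨SkewGL.eq_relations_of_isPBWType hsmall hSL, ?_⟩⟩
  rintro rfl
  exact BimoduleTensor.isPBWType_self (SkewGL.relations_le_deg G) (SkewGL.relations_isSubbimodule G)
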